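/- Let $\theta(t)=\arg\Gamma\left(\tfrac14+\tfrac{it}{2}\right)-\tfrac t2\log\pi$ be the Riemann–Siegel theta function (with the argument continuous in $t$ and equal to $0$ at $t=0$), let $Z(t)=e^{i\theta(t)}\zeta\left(\tfrac12+it\right)$ be the Hardy $Z$-function, and for $t\ge 0$ put $N(t)=[t/2]$. For an integer $N\ge 0$ and $t\ge 0$ let $$\widetilde Z_N(t)=\sum_{n=0}^{N}\frac1{2^{n+1}}\sum_{k=0}^{n}\binom nk\frac{\cos(\theta(t)-t\ln(k+1))}{\sqrt{k+1}}$$ be the accelerated section, and for $k\ge 1$ let $$\widetilde\alpha^{acc}_k(t)=\sum_{n=k-1}^{N(t)}\frac1{2^{n+1}}\binom n{k-1}.$$ Then for every $t\ge 0$ $$\widetilde Z_{N(t)}(t)=\sum_{k=1}^{N(t)+1}\widetilde\alpha^{acc}_k(t)\,\frac{\cos(\theta(t)-t\ln k)}{\sqrt k},$$ and there is a constant $\omega>0$ such that, as $t\to\infty$, $$Z(t)=\widetilde Z_{N(t)}(t)+O(e^{-\omega t})\quad\text{and}\quad Z(t)=\sum_{k=1}^{N(t)}\widetilde\alpha^{acc}_k(t)\,\frac{\cos(\theta(t)-t\ln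 k)}{\sqrt k}+O(e^{-\omega t}).$$ -/

import Mathlib

open Complex in
/-- The Riemann–Siegel theta function
`θ(t) = arg Γ(1/4 + it/2) - (t/2) log π`, where `arg Γ(1/4 + it/2)` is the branch that is continuous
in `t` and vanishes at `t = 0`; its derivative in `t` is `Re ψ(1/4 + it/2) / 2`,
with `ψ = Γ'/Γ` the digamma function. -/
noncomputable def riemannSiegelTheta (t : ℝ) : ℝ :=
  (∫ u in (0 : ℝ)..t, (digamma (1 / 4 + I * (u / 2))).re / 2) - t / 2 * Real.log Real.pi

/-- The Hardy function `Z(t) = exp(i θ(t)) ζ(1/2 + it)`. -/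
noncomputable def hardyZ (t : ℝ) : ℂ :=
  Complex.exp (Complex.I * riemannSiegelTheta t) * riemannZeta (1 / 2 + Complex.I * t)

/-- `N(t) = [t/2]`, used for `t ≥ 0`. -/
noncomputable def spiraOrder (t : ℝ) : ℕ := ⌊t / 2⌋₊

/-- The accelerated section
`∑_{n=0}^{N} 2^{-(n+1)} ∑_{k=0}^{n} binom(n,k) cos(θ(t) - ln(k+1) t) / √(k+1)`. -/
noncomputable def acceleratedSection (N : ℕ) (t : ℝ) : ℝ :=
  ∑ n ∈ Finset.range (N + 1), 1 / 2 ^ (n + 1) *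
    ∑ k ∈ Finset.range (n + 1), (n.choose k : ℝ) *
      (Real.cos (riemannSiegelTheta t - Real.log ((k : ℝ) + 1) * t) / √((k : ℝ) + 1))

/-- The accelerated coefficient `∑_{n=k-1}^{N(t)} 2^{-(n+1)} binom(n,k-1)`, used for `k ≥ 1`. -/
noncomputable def accCoeff (k : ℕ) (t : ℝ) : ℝ :=
  ∑ n ∈ Finset.Icc (k - 1) (spiraOrder t), 1 / 2 ^ (n + 1) * (n.choose (k - 1) : ℝ)

/-! The next facts confirm that `θ(t) + (t/2) log π` is the continuous argument of
`Γ(1/4 + it/2)`. -/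

theorem gammaLine_ne_neg_nat (u : ℝ) (m : ℕ) : (1 / 4 + Complex.I * (u / 2) : ℂ) ≠ -m := by
  intro h
  have h1 := congrArg Complex.re h
  simp at h1
  have : (0 : ℝ) ≤ m := Nat.cast_nonneg m
  linarith

theorem continuous_digammaLine :
    Continuous fun u : ℝ => Complex.digamma (1 / 4 + Complex.I * (u / 2)) := by
  rw [continuous_iff_continuousAt]
  intro u
  have hre : 0 < (1 / 4 + Complex.I * (u / 2) : ℂ).re := by simp
  have hU : IsOpen {s : ℂ | 0 < s.re} := isOpen_lt continuous_const Complex.continuous_re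
  have hd : DifferentiableOn ℂ Complex.Gamma {s : ℂ | 0 < s.re} := fun s hs =>
    (Complex.differentiableAt_Gamma s (fun m h => by
      have h0 : 0 < s.re := hs
      rw [h] at h0
      simp at h0
      have : (0 : ℝ) ≤ m := Nat.cast_nonneg m
      linarith)).differentiableWithinAt
  have h1 : ContinuousAt (deriv Complex.Gamma) (1 / 4 + Complex.I * (u / 2)) :=
    ((hd.deriv hU).differentiableAt (hU.mem_nhds hre)).continuousAt
  have h2 := Complex.continuousAt_Gamma _ (gammaLine_ne_neg_nat u)
  have h3 : ContinuousAt Complex.digamma (1 / 4 + Complex.I * (u / 2)) :=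
    h1.div h2 (Complex.Gamma_ne_zero (gammaLine_ne_neg_nat u))
  exact ContinuousAt.comp (f := fun u : ℝ => (1 / 4 + Complex.I * (u / 2) : ℂ)) h3 (by fun_prop)

theorem continuous_riemannSiegelTheta : Continuous riemannSiegelTheta := by
  unfold riemannSiegelTheta
  have h : Continuous fun u : ℝ => (Complex.digamma (1 / 4 + Complex.I * (u / 2))).re / 2 :=
    (Complex.continuous_re.comp continuous_digammaLine).div_const 2
  have h2 := intervalIntegral.continuous_primitive (μ := MeasureTheory.volume)
    (fun a b => h.intervalIntegrable a b) 0
  exact h2.sub (by fun_prop)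

theorem riemannSiegelTheta_zero : riemannSiegelTheta 0 = 0 := by
  simp [riemannSiegelTheta]

theorem Gamma_eq_norm_mul_exp_theta (t : ℝ) :
    Complex.Gamma (1 / 4 + Complex.I * (t / 2)) =
      ‖Complex.Gamma (1 / 4 + Complex.I * (t / 2))‖ *
        Complex.exp (Complex.I * ((riemannSiegelTheta t + t / 2 * Real.log Real.pi : ℝ) : ℂ)) := by
  set F : ℝ → ℂ := fun u => Complex.I / 2 * Complex.digamma (1 / 4 + Complex.I * (u / 2)) with hF
  have hFc : Continuous F := continuous_digammaLine.const_mul _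
  set P : ℝ → ℂ := fun x => ∫ u in (0 : ℝ)..x, F u with hP
  have hPd : ∀ x, HasDerivAt P (F x) x := fun x =>
    (hFc.integral_hasStrictDerivAt 0 x).hasDerivAt
  have hG : ∀ x : ℝ, HasDerivAt (fun x : ℝ => Complex.Gamma (1 / 4 + Complex.I * (x / 2)))
      (F x * Complex.Gamma (1 / 4 + Complex.I * (x / 2))) x := by
    intro x
    have hne := Complex.Gamma_ne_zero (gammaLine_ne_neg_nat x)
    have h1 := (Complex.differentiableAt_Gamma _ (gammaLine_ne_neg_nat x)).hasDerivAt
    have h2 : HasDerivAt (fun x : ℝ => (1 / 4 + Complex.I * (x / 2) : ℂ))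
        (Complex.I * (1 / 2)) x :=
      (((Complex.ofRealCLM.hasDerivAt (x := x)).div_const 2).const_mul Complex.I).const_add _
    have h3 := h1.comp x h2
    refine h3.congr_deriv ?_
    simp only [hF, Complex.digamma_def, logDeriv_apply]
    rw [mul_assoc, div_mul_cancel₀ _ hne]
    ring
  have hc : ∀ x : ℝ, HasDerivAt
      (fun x : ℝ => Complex.Gamma (1 / 4 + Complex.I * (x / 2)) * Complex.exp (-P x)) 0 x := by
    intro x
    refine ((hG x).mul (hPd x).neg.cexp).congr_deriv ?_
    ring
  have hconst := is_const_of_deriv_eq_zero (fun x => (hc x).differentiableAt)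
    (fun x => (hc x).deriv) t 0
  have hP0 : P 0 = 0 := by simp [hP]
  have hval : Complex.Gamma (1 / 4 + Complex.I * (t / 2)) =
      (Real.Gamma (1 / 4) : ℂ) * Complex.exp (P t) := by
    have h4 : Complex.Gamma (1 / 4 + Complex.I * (t / 2)) * Complex.exp (-P t)
        = Complex.Gamma (1 / 4) := by
      simpa [hP0] using hconst
    rw [← Complex.Gamma_ofReal]
    push_cast
    rw [← h4, mul_assoc, ← Complex.exp_add]
    simp
  have hIm : (P t).im = riemannSiegelTheta t + t / 2 * Real.log Real.pi := by
    have h5 : (P t).im = ∫ u in (0 : ℝ)..t, (F u).im :=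
      (Complex.imCLM.intervalIntegral_comp_comm (hFc.intervalIntegrable 0 t)).symm
    rw [h5, riemannSiegelTheta, sub_add_cancel]
    congr 1
    ext u
    simp [hF]
    ring
  have hpos : 0 < Real.Gamma (1 / 4) := Real.Gamma_pos_of_pos (by norm_num)
  rw [← hIm, hval, norm_mul, Complex.norm_exp, Complex.norm_real, Real.norm_of_nonneg hpos.le]
  push_cast
  rw [mul_assoc, ← Complex.exp_add]
  congr 2
  conv_lhs => rw [← Complex.re_add_im (P t)]
  ring

/-! The section is the real part of `exp(iθ)` times the partial Euler transform `E_N` of the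
Dirichlet series of `ζ`. The functional equation makes `Z(t)` real (`hardyZ_im`), so the error is at
most `|ζ(s) - E_N(s)|` at `s = 1/2 + it`.

Write `a(x) = (1 + e^{-x})/2`. Summing a geometric series shows that, for `Re s > 1`, `Γ(s)(ζ(s) -
E_N(s))` is the Mellin transform of `a(x)^{N+1}/(e^x - 1)` (`mellin_averagedExp_pow_div`). One
integration by parts removes the singularity at `x = 0`, and analytic continuation then reaches the
critical line (`mellin_deriv_eulerKernel`).

The integral has to beat `|Γ(s)|`, which is at least `e^{-πt/2}` (`exp_le_norm_Gamma_critical`). On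
the ray `arg x = π/2 + ψ` the factor `|x^{it}|` equals `e^{-t(π/2+ψ)}`. Since `t` is within 2 of
`2N`, an exponential gain over `e^{-πt/2}` follows once `|a(x)| ≤ e^{2ψ-δ}` with a fixed `δ > 0`.
The imaginary axis itself fails: `|a(iy)| = |cos(y/2)|` equals 1 at 0 and at `2πi`, where the kernel
also has a pole. The contour therefore follows `ψ = 1/20` up to radius `9/5`, crosses on an arc, and
continues along `ψ = -1/20`; there `δ = 1/200` works. Thus `exists_norm_mellin_le` gives `e^{-πt/2}
e^{-N/200}` up to a factor linear in `N`.

The second asymptotic formula drops only the last term of the section, whose coefficient is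
`2^{-(N+1)}`. -/

/-! ### Reduction to the Euler transform of `ζ` on the critical line -/

/-- The partial sum of the Euler transform of the Dirichlet series of `ζ`. -/
noncomputable def eulerPartialSum (N : ℕ) (s : ℂ) : ℂ :=
  ∑ n ∈ Finset.range (N + 1), 1 / 2 ^ (n + 1) *
    ∑ k ∈ Finset.range (n + 1), (n.choose k : ℂ) * (1 / ((k : ℂ) + 1) ^ s)

theorem re_exp_mul_one_div_cpow_critical (a t : ℝ) {x : ℝ} (hx : 0 < x) :
    (Complex.exp (Complex.I * a) * (1 / (x : ℂ) ^ (1 / 2 + Complex.I * t))).re =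
      Real.cos (a - Real.log x * t) / √x := by
  have hx' : (x : ℂ) ≠ 0 := by exact_mod_cast hx.ne'
  have h : Complex.exp (Complex.I * a) * (1 / (x : ℂ) ^ (1 / 2 + Complex.I * t)) =
      ((Real.exp (-(Real.log x / 2)) : ℝ) : ℂ) *
        Complex.exp (((a - Real.log x * t : ℝ) : ℂ) * Complex.I) := by
    rw [Complex.cpow_def_of_ne_zero hx', one_div, ← Complex.exp_neg, ← Complex.exp_add,
      Complex.ofReal_exp, ← Complex.exp_add, ← Complex.ofReal_log hx.le]
    congr 1
    push_cast
    ring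
  rw [h, Complex.re_ofReal_mul, Complex.exp_ofReal_mul_I_re, Real.exp_neg, Real.exp_half,
    Real.exp_log hx]
  field_simp

theorem acceleratedSection_eq_re (N : ℕ) (t : ℝ) :
    acceleratedSection N t =
      (Complex.exp (Complex.I * riemannSiegelTheta t) *
        eulerPartialSum N (1 / 2 + Complex.I * t)).re := by
  rw [acceleratedSection, eulerPartialSum, Finset.mul_sum, Complex.re_sum]
  refine Finset.sum_congr rfl fun n _ => ?_
  rw [Finset.mul_sum, Finset.mul_sum, Finset.mul_sum, Complex.re_sum]
  refine Finset.sum_congr rfl fun k _ => ?_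
  have hk : (0 : ℝ) < (k : ℝ) + 1 := by positivity
  rw [← re_exp_mul_one_div_cpow_critical _ _ hk]
  have : Complex.exp (Complex.I * riemannSiegelTheta t) * (1 / 2 ^ (n + 1) * ((n.choose k : ℂ) *
      (1 / ((k : ℂ) + 1) ^ (1 / 2 + Complex.I * t)))) =
      ((1 / 2 ^ (n + 1) * (n.choose k : ℝ) : ℝ) : ℂ) *
      (Complex.exp (Complex.I * riemannSiegelTheta t) *
        (1 / (((k : ℝ) + 1 : ℝ) : ℂ) ^ (1 / 2 + Complex.I * t))) := by
    push_cast
    ring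
  rw [this, Complex.re_ofReal_mul, mul_assoc]

theorem acceleratedSection_eq_sum_accCoeff (t : ℝ) :
    acceleratedSection (spiraOrder t) t = ∑ k ∈ Finset.Icc 1 (spiraOrder t + 1),
      accCoeff k t * (Real.cos (riemannSiegelTheta t - Real.log k * t) / √(k : ℝ)) := by
  rw [← Finset.Ico_add_one_right_eq_Icc, Finset.sum_Ico_eq_sum_range]
  simp only [acceleratedSection, accCoeff, Finset.mul_sum, Finset.sum_mul]
  rw [Finset.sum_sigma', Finset.sum_sigma']
  refine Finset.sum_bij' (fun x _ => ⟨x.2, x.1⟩) (fun x _ => ⟨x.2, x.1⟩) ?_ ?_ ?_ ?_ ?_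
  · simp only [Finset.mem_sigma, Finset.mem_range, Finset.mem_Icc]
    omega
  · simp only [Finset.mem_sigma, Finset.mem_range, Finset.mem_Icc]
    omega
  · simp
  · simp
  · rintro ⟨n, k⟩ -
    simp only [add_tsub_cancel_left, Nat.cast_add, Nat.cast_one, add_comm (1 : ℝ)]
    ring

theorem conj_critical (t : ℝ) :
    (starRingEnd ℂ) (1 / 2 + Complex.I * t) = 1 - (1 / 2 + Complex.I * t) := by
  simp only [map_add, map_mul, Complex.conj_I, Complex.conj_ofReal, map_div₀, map_one, map_ofNat]
  ring

/-- On the critical line conjugation is `s ↦ 1 - s`, so the functional equation makes the completed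
zeta function real there. Its archimedean factor is a positive number times `exp(iθ)`, hence it is a
positive multiple of `Z`. -/
theorem hardyZ_im (t : ℝ) : (hardyZ t).im = 0 := by
  set s : ℂ := 1 / 2 + Complex.I * t with hs
  have hs0 : s ≠ 0 := fun h => by simpa [hs] using congrArg Complex.re h
  have hs1 : 1 - s ≠ 0 := fun h => by
    have := congrArg Complex.re h
    norm_num [hs] at this
  have hconj : (starRingEnd ℂ) s = 1 - s := conj_critical t
  have hG : ∀ z : ℂ, Complex.Gammaℝ ((starRingEnd ℂ) z) = (starRingEnd ℂ) (Complex.Gammaℝ z) := by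
    intro z
    have h1 : (starRingEnd ℂ) z / 2 = (starRingEnd ℂ) (z / 2) := by rw [map_div₀, map_ofNat]
    have h2 : -(starRingEnd ℂ) z / 2 = (starRingEnd ℂ) (-z / 2) := by
      rw [map_div₀, map_ofNat, map_neg]
    rw [Complex.Gammaℝ_def, Complex.Gammaℝ_def, map_mul, h1, h2, Complex.Gamma_conj,
      Complex.cpow_conj, Complex.conj_ofReal]
    rw [Complex.arg_ofReal_of_nonneg Real.pi_pos.le]
    exact Real.pi_pos.ne
  have hGs : Complex.Gammaℝ s ≠ 0 := Complex.Gammaℝ_ne_zero_of_re_pos (by simp [hs])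
  have hΛ : completedRiemannZeta s = Complex.Gammaℝ s * riemannZeta s := by
    rw [riemannZeta_def_of_ne_zero hs0]
    field_simp
  have hreal : (starRingEnd ℂ) (completedRiemannZeta s) = completedRiemannZeta s := by
    have hGs' : Complex.Gammaℝ (1 - s) ≠ 0 := by
      rw [← hconj, hG]
      simpa using hGs
    have h1 : completedRiemannZeta (1 - s) = Complex.Gammaℝ (1 - s) * riemannZeta (1 - s) := by
      rw [riemannZeta_def_of_ne_zero hs1]
      field_simp
    have h2 : completedRiemannZeta (1 - s) = (starRingEnd ℂ) (completedRiemannZeta s) := by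
      rw [h1, ← hconj, hG, riemannZeta_conj, ← map_mul, ← hΛ]
    rw [← h2, completedRiemannZeta_one_sub]
  have hsg : s / 2 = 1 / 4 + Complex.I * (t / 2) := by
    rw [hs]
    ring
  set c : ℝ := Real.exp (-(Real.log Real.pi / 4)) * ‖Complex.Gamma (1 / 4 + Complex.I * (t / 2))‖
    with hc
  have hcpos : 0 < c := mul_pos (Real.exp_pos _)
    (norm_pos_iff.mpr (Complex.Gamma_ne_zero (gammaLine_ne_neg_nat t)))
  have hpi : (Real.pi : ℂ) ≠ 0 := by exact_mod_cast Real.pi_ne_zero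
  -- The phase of `π^{-s/2}` is `-(t/2) log π`, exactly the correction term in `θ`.
  have hfac : Complex.Gammaℝ s = c * Complex.exp (Complex.I * riemannSiegelTheta t) := by
    rw [Complex.Gammaℝ_def, hsg, Gamma_eq_norm_mul_exp_theta, hc,
      Complex.cpow_def_of_ne_zero hpi, ← Complex.ofReal_log Real.pi_pos.le]
    push_cast
    rw [mul_left_comm, ← Complex.exp_add, mul_comm (Complex.exp _) ((‖_‖ : ℝ) : ℂ), mul_assoc,
      ← Complex.exp_add]
    congr 2
    rw [hs]
    ring
  have hZ : completedRiemannZeta s = c * hardyZ t := by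
    rw [hΛ, hfac, hardyZ, mul_assoc]
  have h := Complex.conj_eq_iff_im.mp hreal
  rw [hZ, Complex.im_ofReal_mul] at h
  exact (mul_eq_zero.mp h).resolve_left hcpos.ne'

/-- Both sides of the difference are real parts of `exp(iθ)` times a complex number, and neither the
unimodular factor nor taking real parts increases the norm. -/
theorem norm_hardyZ_sub_acceleratedSection_le (N : ℕ) (t : ℝ) :
    ‖hardyZ t - ((acceleratedSection N t : ℝ) : ℂ)‖ ≤
      ‖riemannZeta (1 / 2 + Complex.I * t) - eulerPartialSum N (1 / 2 + Complex.I * t)‖ := by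
  have h1 : hardyZ t = (((hardyZ t).re : ℝ) : ℂ) :=
    Complex.ext (by simp) (by simp [hardyZ_im])
  rw [h1, acceleratedSection_eq_re, ← Complex.ofReal_sub, ← Complex.sub_re, Complex.norm_real,
    Real.norm_eq_abs]
  refine (Complex.abs_re_le_norm _).trans_eq ?_
  rw [hardyZ, ← mul_sub, norm_mul, mul_comm Complex.I, Complex.norm_exp_ofReal_mul_I, one_mul]

/-! ### The kernel of the remainder and bounds for its derivative -/

/-- The mean `(1 + e^{-x}) / 2`, the ratio of the geometric sum behind the Euler transform. -/
noncomputable def averagedExp (x : ℂ) : ℂ := (1 + Complex.exp (-x)) / 2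

/-- The function `x / (e^x - 1)`, continued to `x = 0`. -/
noncomputable def bernoulliKernel (x : ℂ) : ℂ := (dslope Complex.exp 0 x)⁻¹

/-- The function `((1 + e^{-x}) / 2)^{N+1} x / (e^x - 1)`. -/
noncomputable def eulerKernel (N : ℕ) (x : ℂ) : ℂ := averagedExp x ^ (N + 1) * bernoulliKernel x

/-- A region free of poles of `eulerKernel`. -/
def kernelRegion : Set ℂ := {x | ‖x‖ ≤ 2 ∨ 1 / 20 ≤ x.re}

theorem differentiable_averagedExp : Differentiable ℂ averagedExp := by
  unfold averagedExp
  fun_prop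

theorem differentiable_dslope_exp : Differentiable ℂ (dslope Complex.exp 0) :=
  differentiableOn_univ.mp
    ((Complex.differentiableOn_dslope Filter.univ_mem).mpr Complex.differentiable_exp.differentiableOn)

theorem dslope_exp_of_ne {x : ℂ} (hx : x ≠ 0) :
    dslope Complex.exp 0 x = (Complex.exp x - 1) / x := by
  rw [dslope_of_ne _ hx, slope_def_field, Complex.exp_zero, sub_zero]

theorem bernoulliKernel_of_ne {x : ℂ} (hx : x ≠ 0) :
    bernoulliKernel x = x / (Complex.exp x - 1) := by
  rw [bernoulliKernel, dslope_exp_of_ne hx, inv_div]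

/-- The zeros of `(e^x - 1)/x` are `2πin` with `n ≠ 0`: they have modulus above 2 and real part 0.
-/
theorem dslope_exp_ne_zero_of_mem {x : ℂ} (hx : x ∈ kernelRegion) :
    dslope Complex.exp 0 x ≠ 0 := by
  rcases eq_or_ne x 0 with rfl | h0
  · simp
  rw [dslope_exp_of_ne h0]
  refine div_ne_zero (fun h => ?_) h0
  obtain ⟨n, hn⟩ := Complex.exp_eq_one_iff.mp (sub_eq_zero.mp h)
  rcases hx with h1 | h1
  · have hn0 : n ≠ 0 := fun h => h0 (by rw [hn, h]; simp)
    have h2 : (1 : ℝ) ≤ |(n : ℝ)| := by exact_mod_cast Int.one_le_abs hn0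
    rw [hn] at h1
    simp only [norm_mul, Complex.norm_intCast, Complex.norm_ofNat, Complex.norm_real,
      Complex.norm_I, mul_one, Real.norm_eq_abs, abs_of_pos Real.pi_pos] at h1
    nlinarith [Real.pi_gt_three]
  · rw [hn] at h1
    norm_num at h1

theorem isOpen_dslope_exp_ne_zero : IsOpen {x : ℂ | dslope Complex.exp 0 x ≠ 0} :=
  isOpen_ne_fun differentiable_dslope_exp.continuous continuous_const

theorem differentiableOn_bernoulliKernel :
    DifferentiableOn ℂ bernoulliKernel {x | dslope Complex.exp 0 x ≠ 0} :=
  fun x hx => ((differentiable_dslope_exp x).inv hx).differentiableWithinAt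

theorem differentiableOn_eulerKernel (N : ℕ) :
    DifferentiableOn ℂ (eulerKernel N) {x | dslope Complex.exp 0 x ≠ 0} :=
  (differentiable_averagedExp.pow (N + 1)).differentiableOn.mul differentiableOn_bernoulliKernel

theorem differentiableAt_eulerKernel (N : ℕ) {x : ℂ} (hx : x ∈ kernelRegion) :
    DifferentiableAt ℂ (eulerKernel N) x :=
  (differentiableOn_eulerKernel N).differentiableAt
    (isOpen_dslope_exp_ne_zero.mem_nhds (dslope_exp_ne_zero_of_mem hx))

theorem differentiableAt_deriv_eulerKernel (N : ℕ) {x : ℂ} (hx : x ∈ kernelRegion) :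
    DifferentiableAt ℂ (deriv (eulerKernel N)) x :=
  ((differentiableOn_eulerKernel N).deriv isOpen_dslope_exp_ne_zero).differentiableAt
    (isOpen_dslope_exp_ne_zero.mem_nhds (dslope_exp_ne_zero_of_mem hx))

theorem deriv_averagedExp (x : ℂ) : HasDerivAt averagedExp (-Complex.exp (-x) / 2) x := by
  have h := (((hasDerivAt_neg x).cexp).const_add (1 : ℂ)).div_const 2
  refine h.congr_deriv ?_
  ring

theorem deriv_eulerKernel (N : ℕ) {x : ℂ} (hx : x ∈ kernelRegion) :
    deriv (eulerKernel N) x = averagedExp x ^ N *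
      (averagedExp x * deriv bernoulliKernel x -
        (N + 1) * (Complex.exp (-x) / 2) * bernoulliKernel x) := by
  have h1 := (deriv_averagedExp x).fun_pow (N + 1)
  have h2 := (differentiableOn_bernoulliKernel.differentiableAt
    (isOpen_dslope_exp_ne_zero.mem_nhds (dslope_exp_ne_zero_of_mem hx))).hasDerivAt
  have h3 : HasDerivAt (eulerKernel N) _ x := h1.fun_mul h2
  rw [h3.deriv]
  push_cast
  rw [pow_succ]
  ring

theorem norm_averagedExp_le (x : ℂ) : ‖averagedExp x‖ ≤ (1 + Real.exp (-x.re)) / 2 := by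
  rw [averagedExp, norm_div, Complex.norm_ofNat]
  gcongr
  refine (norm_add_le _ _).trans_eq ?_
  rw [norm_one, Complex.norm_exp, Complex.neg_re]

theorem norm_averagedExp_le_one {x : ℂ} (hx : 0 ≤ x.re) : ‖averagedExp x‖ ≤ 1 := by
  have h1 := norm_averagedExp_le x
  have h2 : Real.exp (-x.re) ≤ 1 := Real.exp_le_one_iff.mpr (by linarith)
  linarith

/-- The constant comes from `e^{Re x} ≥ 1 + 1/20 = 21/20`, which gives `e^{Re x} - 1 ≥ e^{Re x}/21`.
-/
theorem inv_exp_sub_one_bound {x : ℂ} (hx : 1 / 20 ≤ x.re) :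
    Real.exp x.re / 21 ≤ ‖Complex.exp x - 1‖ := by
  have h1 : ‖Complex.exp x‖ - ‖(1 : ℂ)‖ ≤ ‖Complex.exp x - 1‖ := norm_sub_norm_le _ _
  rw [Complex.norm_exp, norm_one] at h1
  have h2 := Real.add_one_le_exp x.re
  linarith

theorem norm_bernoulliKernel_le {x : ℂ} (hx : 1 / 20 ≤ x.re) :
    ‖bernoulliKernel x‖ ≤ 21 * ‖x‖ * Real.exp (-x.re) := by
  have h0 : x ≠ 0 := fun h => by norm_num [h] at hx
  have h1 := inv_exp_sub_one_bound hx
  have h2 := Real.exp_pos x.re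
  rw [bernoulliKernel_of_ne h0, norm_div, div_le_iff₀ (by linarith), Real.exp_neg]
  calc ‖x‖ = 21 * ‖x‖ * (Real.exp x.re)⁻¹ * (Real.exp x.re / 21) := by field_simp
    _ ≤ _ := by gcongr

theorem norm_deriv_bernoulliKernel_le {x : ℂ} (hx : 1 / 20 ≤ x.re) :
    ‖deriv bernoulliKernel x‖ ≤ 882 * (1 + ‖x‖) * Real.exp (-x.re) := by
  have h0 : x ≠ 0 := fun h => by norm_num [h] at hx
  have h1 := inv_exp_sub_one_bound hx
  have h2 := Real.exp_pos x.re
  have hne : Complex.exp x - 1 ≠ 0 := norm_pos_iff.mp (by linarith)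
  have h3 : HasDerivAt bernoulliKernel
      ((1 * (Complex.exp x - 1) - x * Complex.exp x) / (Complex.exp x - 1) ^ 2) x := by
    refine ((hasDerivAt_id x).fun_div ((Complex.hasDerivAt_exp x).sub_const 1) hne).congr_of_eventuallyEq ?_
    filter_upwards [isOpen_ne.mem_nhds h0] with y hy
    exact bernoulliKernel_of_ne hy
  have h4 : ‖1 * (Complex.exp x - 1) - x * Complex.exp x‖ ≤ 2 * ((1 + ‖x‖) * Real.exp x.re) := by
    have h5 : 1 * (Complex.exp x - 1) - x * Complex.exp x = (1 - x) * Complex.exp x - 1 := by ring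
    have h6 : ‖(1 - x) * Complex.exp x‖ ≤ (1 + ‖x‖) * Real.exp x.re := by
      rw [norm_mul, Complex.norm_exp]
      gcongr
      exact (norm_sub_le _ _).trans_eq (by rw [norm_one])
    have h7 : 1 ≤ (1 + ‖x‖) * Real.exp x.re :=
      one_le_mul_of_one_le_of_one_le (by linarith [norm_nonneg x])
        (Real.one_le_exp (by linarith))
    rw [h5]
    refine (norm_sub_le _ _).trans ?_
    rw [norm_one]
    linarith
  rw [h3.deriv, norm_div, norm_pow, div_le_iff₀ (by positivity), Real.exp_neg]
  have h6 : (Real.exp x.re / 21) ^ 2 ≤ ‖Complex.exp x - 1‖ ^ 2 := by gcongr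
  calc _ ≤ 2 * ((1 + ‖x‖) * Real.exp x.re) := h4
    _ = 882 * (1 + ‖x‖) * (Real.exp x.re)⁻¹ * (Real.exp x.re / 21) ^ 2 := by
      field_simp
      norm_num
    _ ≤ _ := by gcongr

/-- What matters is uniformity in `N`: differentiating the power costs one factor `N + 1`, and the
remaining dependence on `N` is the explicit power of `averagedExp`. Compactness handles the disc,
explicit decay the half-plane. -/
theorem exists_norm_deriv_eulerKernel_le : ∃ C : ℝ, 0 < C ∧ ∀ (N : ℕ), ∀ x ∈ kernelRegion,
    ‖deriv (eulerKernel N) x‖ ≤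
      C * (N + 1) * ‖averagedExp x‖ ^ N * ((1 + ‖x‖) * Real.exp (-x.re)) := by
  have hsub : Metric.closedBall (0 : ℂ) 2 ⊆ {x | dslope Complex.exp 0 x ≠ 0} := fun x hx =>
    dslope_exp_ne_zero_of_mem (Or.inl (by simpa using hx))
  have hK := isCompact_closedBall (0 : ℂ) 2
  obtain ⟨A, hA⟩ := hK.exists_bound_of_continuousOn
    (differentiableOn_bernoulliKernel.continuousOn.mono hsub)
  obtain ⟨B, hB⟩ := hK.exists_bound_of_continuousOn
    ((differentiableOn_bernoulliKernel.deriv isOpen_dslope_exp_ne_zero).continuousOn.mono hsub)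
  have hA0 : 0 ≤ A := (norm_nonneg _).trans (hA 0 (by simp))
  have hB0 : 0 ≤ B := (norm_nonneg _).trans (hB 0 (by simp))
  have hbd : ∃ D : ℝ, 0 < D ∧ ∀ x ∈ kernelRegion,
      ‖averagedExp x * deriv bernoulliKernel x‖ ≤ D * ((1 + ‖x‖) * Real.exp (-x.re)) ∧
      ‖Complex.exp (-x) / 2 * bernoulliKernel x‖ ≤ D * ((1 + ‖x‖) * Real.exp (-x.re)) := by
    -- On the disc, `‖averagedExp x‖ ≤ e^2` and `e^{-Re x} ≥ e^{-2}`, whence `e^4`; the half-plane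
    -- needs `882 = 2 · 21^2`.
    refine ⟨A + Real.exp 4 * B + 882, by positivity, fun x hx => ?_⟩
    have he := Real.exp_pos (-x.re)
    rw [norm_mul, norm_mul, norm_div, Complex.norm_exp, Complex.neg_re, Complex.norm_ofNat]
    by_cases h : 1 / 20 ≤ x.re
    · have h1 := norm_bernoulliKernel_le h
      have h2 := norm_deriv_bernoulliKernel_le h
      have h3 : ‖averagedExp x‖ ≤ 1 := norm_averagedExp_le_one (by linarith)
      have h4 : Real.exp (-x.re) ≤ 1 := Real.exp_le_one_iff.mpr (by linarith)
      have hP : 0 ≤ (1 + ‖x‖) * Real.exp (-x.re) := by positivity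
      have hQ : 0 ≤ (A + Real.exp 4 * B) * ((1 + ‖x‖) * Real.exp (-x.re)) := by positivity
      constructor
      · calc _ ≤ 1 * (882 * (1 + ‖x‖) * Real.exp (-x.re)) := by gcongr
          _ ≤ _ := by linarith
      · calc _ ≤ 1 / 2 * (21 * ‖x‖ * Real.exp (-x.re)) := by gcongr
          _ ≤ _ := by nlinarith
    · have hx2 : ‖x‖ ≤ 2 := hx.resolve_right h
      have hm : x ∈ Metric.closedBall (0 : ℂ) 2 := by simpa using hx2
      have hre := abs_le.mp ((Complex.abs_re_le_norm x).trans hx2)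
      have h1 : ‖averagedExp x‖ ≤ Real.exp 2 := by
        have h5 := norm_averagedExp_le x
        have h6 : Real.exp (-x.re) ≤ Real.exp 2 := Real.exp_le_exp.mpr (by linarith)
        have h7 : 1 ≤ Real.exp 2 := Real.one_le_exp (by norm_num)
        linarith
      have h2 : Real.exp 2 ≤ Real.exp 4 * Real.exp (-x.re) := by
        rw [← Real.exp_add]
        exact Real.exp_le_exp.mpr (by linarith)
      have h8 : 1 ≤ 1 + ‖x‖ := by linarith [norm_nonneg x]
      constructor
      · calc _ ≤ Real.exp 2 * B := by gcongr; exact hB x hm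
          _ ≤ (Real.exp 4 * Real.exp (-x.re)) * B := by gcongr
          _ = Real.exp 4 * B * (1 * Real.exp (-x.re)) := by ring
          _ ≤ _ := by gcongr; linarith
      · calc _ ≤ Real.exp (-x.re) / 2 * A := by gcongr; exact hA x hm
          _ ≤ A * (1 * Real.exp (-x.re)) := by nlinarith
          _ ≤ _ := by gcongr; nlinarith [Real.exp_pos 4]
  obtain ⟨D, hD, hbd⟩ := hbd
  refine ⟨2 * D, by positivity, fun N x hx => ?_⟩
  obtain ⟨h1, h2⟩ := hbd x hx
  have hP : 0 ≤ (1 + ‖x‖) * Real.exp (-x.re) := by positivity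
  rw [deriv_eulerKernel N hx, norm_mul, norm_pow]
  have h3 : ‖averagedExp x * deriv bernoulliKernel x -
      (N + 1) * (Complex.exp (-x) / 2) * bernoulliKernel x‖ ≤
      2 * D * (N + 1) * ((1 + ‖x‖) * Real.exp (-x.re)) := by
    refine (norm_sub_le _ _).trans ?_
    have h4 : ‖((N : ℂ) + 1)‖ = N + 1 := by exact_mod_cast Complex.norm_natCast (N + 1)
    rw [mul_assoc (_ + 1), norm_mul (_ + 1), h4]
    have h5 : ((N : ℝ) + 1) * ‖Complex.exp (-x) / 2 * bernoulliKernel x‖ ≤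
      (N + 1) * (D * ((1 + ‖x‖) * Real.exp (-x.re))) := by gcongr
    have h6 : 0 ≤ (N : ℝ) * (D * ((1 + ‖x‖) * Real.exp (-x.re))) := by positivity
    linarith
  calc _ ≤ ‖averagedExp x‖ ^ N * (2 * D * (N + 1) * ((1 + ‖x‖) * Real.exp (-x.re))) := by gcongr
    _ = _ := by ring

open Filter Topology Asymptotics in
theorem isBigO_one_add_mul_exp_neg :
    (fun x : ℝ => (1 + x) * Real.exp (-x)) =O[atTop] fun x => Real.exp (-(1 / 2) * x) := by
  refine IsBigO.of_bound 2 ?_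
  filter_upwards [eventually_ge_atTop 0] with x hx
  rw [Real.norm_of_nonneg (by positivity), Real.norm_of_nonneg (Real.exp_pos _).le]
  have h1 : 1 + x ≤ 2 * Real.exp (x / 2) := by linarith [Real.add_one_le_exp (x / 2)]
  calc (1 + x) * Real.exp (-x) ≤ 2 * Real.exp (x / 2) * Real.exp (-x) := by gcongr
    _ = _ := by
      rw [mul_assoc, ← Real.exp_add]
      ring_nf

/-! ### Mellin representation of the remainder for `Re s > 1` -/

/-- The weights with which the Euler transform of order `N` counts the terms of a series. -/
noncomputable def eulerWeight (N k : ℕ) : ℂ :=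
  ∑ n ∈ Finset.range (N + 1), 1 / 2 ^ (n + 1) * (n.choose k : ℂ)

theorem sum_eulerWeight_mul (N : ℕ) (f : ℕ → ℂ) :
    ∑ n ∈ Finset.range (N + 1), 1 / 2 ^ (n + 1) *
      ∑ k ∈ Finset.range (n + 1), (n.choose k : ℂ) * f k =
    ∑ k ∈ Finset.range (N + 1), eulerWeight N k * f k := by
  simp only [eulerWeight, Finset.sum_mul]
  rw [Finset.sum_comm]
  refine Finset.sum_congr rfl fun n hn => ?_
  rw [Finset.mul_sum]
  have hsub : Finset.range (n + 1) ⊆ Finset.range (N + 1) := by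
    rw [Finset.range_subset_range]
    simp only [Finset.mem_range] at hn
    omega
  rw [← Finset.sum_subset hsub]
  · exact Finset.sum_congr rfl fun k _ => by ring
  · intro k _ hk
    rw [Nat.choose_eq_zero_of_lt (by simpa using hk)]
    simp

theorem eulerWeight_eq_zero {N k : ℕ} (hk : N < k) : eulerWeight N k = 0 :=
  Finset.sum_eq_zero fun n hn => by
    rw [Nat.choose_eq_zero_of_lt (by simp only [Finset.mem_range] at hn; omega)]
    simp

theorem hasSum_eulerWeight_mul (N : ℕ) (f : ℕ → ℂ) :
    HasSum (fun k => eulerWeight N k * f k)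
      (∑ k ∈ Finset.range (N + 1), eulerWeight N k * f k) :=
  hasSum_sum_of_ne_finset_zero fun k hk => by
    rw [eulerWeight_eq_zero (by simpa using hk), zero_mul]

/-- With `z = e^{-x}`, the binomial theorem turns the `n`-th block of the Euler transform of `∑
z^{k+1}` into `(z/2)((1+z)/2)^n`. The blocks form a geometric series with the same total `z/(1-z)`,
so its tail is `((1+z)/2)^{N+1} z/(1-z)`. -/
theorem hasSum_one_sub_eulerWeight_mul_exp (N : ℕ) {x : ℝ} (hx : 0 < x) :
    HasSum (fun k : ℕ => (1 - eulerWeight N k) * (Real.exp (-((k : ℝ) + 1) * x) : ℂ))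
      (averagedExp x ^ (N + 1) / (Complex.exp x - 1)) := by
  set z : ℂ := Complex.exp (-x) with hz
  have hz1 : ‖z‖ < 1 := by
    rw [hz, Complex.norm_exp]
    simpa using hx
  have hterm : ∀ k : ℕ, (Real.exp (-((k : ℝ) + 1) * x) : ℂ) = z * z ^ k := by
    intro k
    rw [hz, ← Complex.exp_nat_mul, ← Complex.exp_add]
    push_cast
    ring_nf
  have hne : 1 - z ≠ 0 := fun h => by
    rw [← sub_eq_zero.mp h] at hz1
    simp at hz1
  have hz0 : z ≠ 0 := Complex.exp_ne_zero _
  have hexp : Complex.exp x = z⁻¹ := by rw [hz, Complex.exp_neg, inv_inv]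
  have h1 := ((hasSum_geometric_of_norm_lt_one hz1).mul_left z).sub
    (hasSum_eulerWeight_mul N (fun k => z * z ^ k))
  simp only [hterm, sub_mul, one_mul]
  convert! h1 using 1
  rw [← sum_eulerWeight_mul]
  have h2 : ∀ n : ℕ, 1 / 2 ^ (n + 1) *
      ∑ k ∈ Finset.range (n + 1), (n.choose k : ℂ) * (z * z ^ k) =
      z / 2 * ((1 + z) / 2) ^ n := by
    intro n
    have h3 : ∑ k ∈ Finset.range (n + 1), (n.choose k : ℂ) * (z * z ^ k) = z * (1 + z) ^ n := by
      rw [add_comm 1 z, add_pow, Finset.mul_sum]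
      exact Finset.sum_congr rfl fun k _ => by rw [one_pow]; ring
    rw [h3, div_pow, pow_succ]
    field_simp
  simp only [h2]
  rw [← Finset.mul_sum, geom_sum_eq (fun h => hne (by linear_combination -2 * h)), averagedExp,
    ← hz, hexp]
  have hne' : (1 + z) / 2 - 1 ≠ 0 := fun h => hne (by linear_combination -2 * h)
  have hne'' : z⁻¹ - 1 ≠ 0 := by
    rw [inv_eq_one_div, div_sub_one hz0]
    exact div_ne_zero hne hz0
  rw [inv_eq_one_div, div_sub_one hz0, show (1 + z) / 2 - 1 = -(1 - z) / 2 by ring]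
  field_simp
  ring

theorem mellin_averagedExp_pow_div (N : ℕ) {s : ℂ} (hs : 1 < s.re) :
    mellin (fun x : ℝ => averagedExp x ^ (N + 1) / (Complex.exp x - 1)) s =
      Complex.Gamma s * (riemannZeta s - eulerPartialSum N s) := by
  have hp : ∀ i : ℕ, 1 - eulerWeight N i = 0 ∨ (0 : ℝ) < (i : ℝ) + 1 := fun i =>
    Or.inr (by positivity)
  have hZ : Summable fun i : ℕ => 1 / ((i : ℂ) + 1) ^ s := by
    have h := (summable_nat_add_iff 1).mpr (Complex.summable_one_div_nat_cpow.mpr hs)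
    simpa using h
  have hsum := hZ.hasSum.sub (hasSum_eulerWeight_mul N (fun k => 1 / ((k : ℂ) + 1) ^ s))
  rw [← zeta_eq_tsum_one_div_nat_add_one_cpow hs, ← sum_eulerWeight_mul] at hsum
  have hnorm : Summable fun i : ℕ => ‖1 - eulerWeight N i‖ / ((i : ℝ) + 1) ^ s.re := by
    refine hsum.summable.norm.congr fun i => ?_
    have h1 : 1 / ((i : ℂ) + 1) ^ s - eulerWeight N i * (1 / ((i : ℂ) + 1) ^ s) =
        (1 - eulerWeight N i) / (((i : ℝ) + 1 : ℝ) : ℂ) ^ s := by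
      push_cast
      ring
    rw [h1, norm_div, Complex.norm_cpow_eq_rpow_re_of_pos (by positivity)]
  have h := hasSum_mellin hp (by linarith : 0 < s.re)
    (fun x hx => hasSum_one_sub_eulerWeight_mul_exp N hx) hnorm
  have h2 := hsum.mul_left (Complex.Gamma s)
  refine (h.unique ?_).trans (by rw [eulerPartialSum])
  convert! h2 using 2 with i
  push_cast
  ring

/-! ### Continuation of the Mellin representation to the critical line -/

open Filter Topology Asymptotics MeasureTheory

theorem ofReal_mem_kernelRegion {x : ℝ} (hx : 0 ≤ x) : (x : ℂ) ∈ kernelRegion := by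
  rcases le_total x 2 with h | h
  · exact Or.inl (by rwa [Complex.norm_real, Real.norm_of_nonneg hx])
  · exact Or.inr (by rw [Complex.ofReal_re]; linarith)

theorem continuousOn_deriv_eulerKernel_ofReal (N : ℕ) :
    ContinuousOn (fun x : ℝ => deriv (eulerKernel N) x) (Set.Ici 0) := fun _ hx =>
  ((differentiableAt_deriv_eulerKernel N (ofReal_mem_kernelRegion hx)).continuousAt.comp
    (f := fun x : ℝ => (x : ℂ)) Complex.continuous_ofReal.continuousAt).continuousWithinAt

theorem continuousOn_eulerKernel_ofReal (N : ℕ) :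
    ContinuousOn (fun x : ℝ => eulerKernel N x) (Set.Ici 0) := fun _ hx =>
  ((differentiableAt_eulerKernel N (ofReal_mem_kernelRegion hx)).continuousAt.comp
    (f := fun x : ℝ => (x : ℂ)) Complex.continuous_ofReal.continuousAt).continuousWithinAt

theorem isBigO_nhdsGT_rpow_neg_zero {f : ℝ → ℂ} (hf : ContinuousOn f (Set.Ici 0)) :
    f =O[𝓝[>] 0] fun x : ℝ => x ^ (-(0 : ℝ)) := by
  have h : Tendsto f (𝓝[>] 0) (𝓝 (f 0)) :=
    (hf 0 Set.self_mem_Ici).mono_left (nhdsWithin_mono _ Set.Ioi_subset_Ici_self)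
  simpa using h.isBigO_one ℝ

theorem isBigO_deriv_eulerKernel_atTop (N : ℕ) :
    (fun x : ℝ => deriv (eulerKernel N) x) =O[atTop] fun x : ℝ => Real.exp (-(1 / 2) * x) := by
  obtain ⟨C, hC, hbd⟩ := exists_norm_deriv_eulerKernel_le
  refine IsBigO.trans (IsBigO.of_bound (C * (N + 1)) ?_) isBigO_one_add_mul_exp_neg
  filter_upwards [eventually_ge_atTop 0] with x hx
  refine (hbd N x (ofReal_mem_kernelRegion hx)).trans ?_
  have h1 : ‖averagedExp x‖ ^ N ≤ 1 :=
    pow_le_one₀ (norm_nonneg _) (norm_averagedExp_le_one (by simpa using hx))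
  rw [Complex.norm_real, Real.norm_of_nonneg hx, Complex.ofReal_re,
    Real.norm_of_nonneg (by positivity : 0 ≤ (1 + x) * Real.exp (-x))]
  calc _ ≤ C * (N + 1) * 1 * ((1 + x) * Real.exp (-x)) := by gcongr
    _ = _ := by ring

theorem mellinConvergent_deriv_eulerKernel (N : ℕ) {s : ℂ} (hs : 0 < s.re) :
    MellinConvergent (fun x : ℝ => deriv (eulerKernel N) x) s :=
  mellinConvergent_of_isBigO_rpow_exp (by norm_num : (0 : ℝ) < 1 / 2)
    (((continuousOn_deriv_eulerKernel_ofReal N).mono Set.Ioi_subset_Ici_self).locallyIntegrableOn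
      measurableSet_Ioi)
    (isBigO_deriv_eulerKernel_atTop N)
    (isBigO_nhdsGT_rpow_neg_zero (continuousOn_deriv_eulerKernel_ofReal N)) hs

theorem differentiableAt_mellin_deriv_eulerKernel (N : ℕ) {s : ℂ} (hs : 0 < s.re) :
    DifferentiableAt ℂ (mellin fun x : ℝ => deriv (eulerKernel N) x) s :=
  mellin_differentiableAt_of_isBigO_rpow_exp (by norm_num : (0 : ℝ) < 1 / 2)
    (((continuousOn_deriv_eulerKernel_ofReal N).mono Set.Ioi_subset_Ici_self).locallyIntegrableOn
      measurableSet_Ioi)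
    (isBigO_deriv_eulerKernel_atTop N)
    (isBigO_nhdsGT_rpow_neg_zero (continuousOn_deriv_eulerKernel_ofReal N)) hs

theorem isBigO_eulerKernel_atTop (N : ℕ) :
    (fun x : ℝ => eulerKernel N x) =O[atTop] fun x : ℝ => Real.exp (-(1 / 2) * x) := by
  refine IsBigO.trans (IsBigO.of_bound 21 ?_) isBigO_one_add_mul_exp_neg
  filter_upwards [eventually_ge_atTop 1] with x hx
  have hx0 : 0 ≤ x := by linarith
  have h1 : ‖averagedExp x‖ ^ (N + 1) ≤ 1 :=
    pow_le_one₀ (norm_nonneg _) (norm_averagedExp_le_one (by simpa using hx0))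
  have h2 := norm_bernoulliKernel_le (x := x) (by rw [Complex.ofReal_re]; linarith)
  rw [Complex.norm_real, Real.norm_of_nonneg hx0, Complex.ofReal_re] at h2
  rw [eulerKernel, norm_mul, norm_pow,
    Real.norm_of_nonneg (by positivity : 0 ≤ (1 + x) * Real.exp (-x))]
  calc _ ≤ 1 * (21 * x * Real.exp (-x)) := by gcongr
    _ ≤ _ := by nlinarith [Real.exp_pos (-x)]

theorem mellinConvergent_eulerKernel (N : ℕ) {s : ℂ} (hs : 0 < s.re) :
    MellinConvergent (fun x : ℝ => eulerKernel N x) s :=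
  mellinConvergent_of_isBigO_rpow_exp (by norm_num : (0 : ℝ) < 1 / 2)
    (((continuousOn_eulerKernel_ofReal N).mono Set.Ioi_subset_Ici_self).locallyIntegrableOn
      measurableSet_Ioi)
    (isBigO_eulerKernel_atTop N)
    (isBigO_nhdsGT_rpow_neg_zero (continuousOn_eulerKernel_ofReal N)) hs

theorem mellin_eulerKernel_sub_one (N : ℕ) (s : ℂ) :
    mellin (fun x : ℝ => eulerKernel N x) (s - 1) =
      mellin (fun x : ℝ => averagedExp x ^ (N + 1) / (Complex.exp x - 1)) s := by
  rw [mellin, mellin]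
  refine setIntegral_congr_fun measurableSet_Ioi fun x hx => ?_
  have hx0 : (x : ℂ) ≠ 0 := by exact_mod_cast (ne_of_gt hx)
  simp only [smul_eq_mul, eulerKernel]
  rw [bernoulliKernel_of_ne hx0, Complex.cpow_sub _ _ hx0, Complex.cpow_one]
  field_simp

/-- Integration by parts against `x^{s-1}`. The gain is on the left: the differentiated kernel is
bounded at 0, so its transform converges for `Re s > 0`. -/
theorem mellin_deriv_eulerKernel_of_one_lt_re (N : ℕ) {s : ℂ} (hs : 1 < s.re) :
    mellin (fun x : ℝ => deriv (eulerKernel N) x) s =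
      -(s - 1) * (Complex.Gamma s * (riemannZeta s - eulerPartialSum N s)) := by
  have hs1 : 0 < (s - 1).re := by simpa using hs
  have hu : ∀ x ∈ Set.Ioi (0 : ℝ), HasDerivAt (fun x : ℝ => (x : ℂ) ^ (s - 1))
      ((s - 1) * (x : ℂ) ^ (s - 1 - 1)) x := fun x hx => by
    have h := (hasDerivAt_id (x : ℂ)).cpow_const (c := s - 1)
      (Or.inl (by simpa using hx))
    simpa using h.comp_ofReal
  have hv : ∀ x ∈ Set.Ioi (0 : ℝ), HasDerivAt (fun x : ℝ => eulerKernel N x)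
      (deriv (eulerKernel N) x) x := fun x hx =>
    (differentiableAt_eulerKernel N
      (ofReal_mem_kernelRegion (le_of_lt hx))).hasDerivAt.comp_ofReal
  have huv' : IntegrableOn ((fun x : ℝ => (x : ℂ) ^ (s - 1)) *
      fun x : ℝ => deriv (eulerKernel N) x) (Set.Ioi 0) :=
    mellinConvergent_deriv_eulerKernel N (by linarith)
  have hu'v : IntegrableOn ((fun x : ℝ => (s - 1) * (x : ℂ) ^ (s - 1 - 1)) *
      fun x : ℝ => eulerKernel N x) (Set.Ioi 0) := by
    have h : IntegrableOn (fun x : ℝ => (s - 1) * ((x : ℂ) ^ (s - 1 - 1) • eulerKernel N x))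
        (Set.Ioi 0) := (mellinConvergent_eulerKernel N hs1).const_mul (s - 1)
    refine h.congr_fun (fun x _ => ?_) measurableSet_Ioi
    simp only [smul_eq_mul, Pi.mul_apply]
    ring
  have hpow : (fun x : ℝ => (x : ℂ) ^ (s - 1)) =O[atTop] fun x : ℝ => x ^ (s - 1).re := by
    refine IsBigO.of_bound 1 ?_
    filter_upwards [eventually_gt_atTop 0] with x hx
    rw [Complex.norm_cpow_eq_rpow_re_of_pos hx, one_mul]
    exact le_abs_self _
  have h_zero : Tendsto ((fun x : ℝ => (x : ℂ) ^ (s - 1)) * fun x : ℝ => eulerKernel N x)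
      (𝓝[>] 0) (𝓝 0) := by
    have h1 : Tendsto (fun x : ℝ => (x : ℂ) ^ (s - 1)) (𝓝[>] 0) (𝓝 0) := by
      have h := (Complex.continuousAt_ofReal_cpow_const 0 (s - 1) (Or.inl hs1)).tendsto
      rw [Complex.ofReal_zero, Complex.zero_cpow (fun h => by simp [h] at hs1)] at h
      exact h.mono_left nhdsWithin_le_nhds
    have h2 : Tendsto (fun x : ℝ => eulerKernel N x) (𝓝[>] 0) (𝓝 (eulerKernel N (0 : ℝ))) :=
      ((continuousOn_eulerKernel_ofReal N) 0 Set.self_mem_Ici).mono_left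
        (nhdsWithin_mono _ Set.Ioi_subset_Ici_self)
    have h3 := h1.mul h2
    rw [zero_mul] at h3
    exact h3
  have h_infty : Tendsto ((fun x : ℝ => (x : ℂ) ^ (s - 1)) * fun x : ℝ => eulerKernel N x)
      atTop (𝓝 0) := by
    refine IsBigO.trans_tendsto (hpow.mul (isBigO_eulerKernel_atTop N)) ?_
    simpa using tendsto_rpow_mul_exp_neg_mul_atTop_nhds_zero (s - 1).re (1 / 2) (by norm_num)
  have h := integral_Ioi_mul_deriv_eq_deriv_mul hu hv huv' hu'v h_zero h_infty
  rw [← mellin_averagedExp_pow_div N hs, ← mellin_eulerKernel_sub_one, mellin, mellin]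
  simp only [smul_eq_mul]
  rw [h, sub_zero, zero_sub, neg_mul, ← integral_const_mul]
  simp only [mul_assoc]

/-- Identity theorem on the open first quadrant, which is connected, meets `Re s > 1`, and avoids
the poles of `ζ` and `Γ`. -/
theorem mellin_deriv_eulerKernel (N : ℕ) {s : ℂ} (hs : 0 < s.re) (hs' : 0 < s.im) :
    mellin (fun x : ℝ => deriv (eulerKernel N) x) s =
      -(s - 1) * (Complex.Gamma s * (riemannZeta s - eulerPartialSum N s)) := by
  set U : Set ℂ := {z | 0 < z.re} ∩ {z | 0 < z.im} with hU
  have hUo : IsOpen U := (isOpen_lt continuous_const Complex.continuous_re).inter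
    (isOpen_lt continuous_const Complex.continuous_im)
  have hUc : IsPreconnected U :=
    ((convex_halfSpace_re_gt 0).inter (convex_halfSpace_im_gt 0)).isPreconnected
  have hf : AnalyticOnNhd ℂ (mellin fun x : ℝ => deriv (eulerKernel N) x) U :=
    DifferentiableOn.analyticOnNhd (fun z hz =>
      (differentiableAt_mellin_deriv_eulerKernel N hz.1).differentiableWithinAt) hUo
  have hg : AnalyticOnNhd ℂ (fun z => -(z - 1) *
      (Complex.Gamma z * (riemannZeta z - eulerPartialSum N z))) U := by
    refine DifferentiableOn.analyticOnNhd (fun z hz => DifferentiableAt.differentiableWithinAt ?_)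
      hUo
    have hz1 : z ≠ 1 := fun h => by simpa [h] using hz.2
    have hΓ : DifferentiableAt ℂ Complex.Gamma z :=
      Complex.differentiableAt_Gamma z fun m h => by simpa [h] using hz.2
    have hζ := differentiableAt_riemannZeta hz1
    have hA : DifferentiableAt ℂ (eulerPartialSum N) z := by
      unfold eulerPartialSum
      refine DifferentiableAt.fun_sum fun n _ => DifferentiableAt.const_mul
        (DifferentiableAt.fun_sum fun k _ => DifferentiableAt.const_mul ?_ _) _
      have hk : (k : ℂ) + 1 ≠ 0 := by exact_mod_cast Nat.succ_ne_zero k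
      exact (differentiableAt_const _).div (differentiableAt_id.const_cpow (Or.inl hk))
        (by simp [Complex.cpow_eq_zero_iff, hk])
    exact (differentiableAt_id.sub_const 1).neg.mul (hΓ.mul (hζ.sub hA))
  have hmem : (2 + Complex.I) ∈ U := ⟨by simp, by simp⟩
  refine hf.eqOn_of_preconnected_of_eventuallyEq hg hUc hmem ?_ ⟨hs, hs'⟩
  have hV : IsOpen {z : ℂ | 1 < z.re} := isOpen_lt continuous_const Complex.continuous_re
  filter_upwards [hV.mem_nhds (show (2 + Complex.I) ∈ {z : ℂ | 1 < z.re} by simp)] with z hz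
  exact mellin_deriv_eulerKernel_of_one_lt_re N hz

/-! ### Size of `averagedExp` on the deformed contour -/

theorem norm_averagedExp_sq (x : ℂ) : ‖averagedExp x‖ ^ 2 =
    (1 + 2 * Real.exp (-x.re) * Real.cos x.im + Real.exp (-x.re) ^ 2) / 4 := by
  rw [averagedExp, norm_div, div_pow, ← Complex.normSq_eq_norm_sq, Complex.normSq_apply,
    Complex.norm_ofNat]
  simp only [Complex.add_re, Complex.add_im, Complex.one_re, Complex.one_im, Complex.exp_re,
    Complex.exp_im, Complex.neg_re, Complex.neg_im, Real.cos_neg, Real.sin_neg]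
  linear_combination (Real.exp (-x.re) ^ 2 / 4) * Real.sin_sq_add_cos_sq x.im

/-- For `Im x` in `[π/2, 3π/2]` the cosine in the cross term is nonpositive. This cancellation
supplies the gain where the triangle inequality is too weak. -/
theorem norm_averagedExp_sq_le {x : ℂ} (h1 : Real.pi / 2 ≤ x.im)
    (h2 : x.im ≤ Real.pi + Real.pi / 2) :
    ‖averagedExp x‖ ^ 2 ≤ (1 + Real.exp (-(2 * x.re))) / 4 := by
  have h3 := Real.cos_nonpos_of_pi_div_two_le_of_le h1 h2
  have h4 : Real.exp (-(2 * x.re)) = Real.exp (-x.re) ^ 2 := by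
    rw [← Real.exp_nat_mul]
    congr 1
    push_cast
    ring
  rw [norm_averagedExp_sq, h4]
  nlinarith [Real.exp_pos (-x.re)]

theorem exp_re_of_im_eq (u ψ : ℝ) :
    (Complex.exp (u + (Real.pi / 2 + ψ : ℝ) * Complex.I)).re = -(Real.exp u * Real.sin ψ) := by
  rw [Complex.exp_re]
  simp only [Complex.add_re, Complex.add_im, Complex.ofReal_re, Complex.ofReal_im,
    Complex.re_ofReal_mul, Complex.im_ofReal_mul, Complex.I_re, Complex.I_im, mul_zero, mul_one,
    add_zero, zero_add]
  rw [add_comm (Real.pi / 2), Real.cos_add_pi_div_two]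
  ring

theorem exp_im_of_im_eq (u ψ : ℝ) :
    (Complex.exp (u + (Real.pi / 2 + ψ : ℝ) * Complex.I)).im = Real.exp u * Real.cos ψ := by
  rw [Complex.exp_im]
  simp only [Complex.add_re, Complex.add_im, Complex.ofReal_re, Complex.ofReal_im,
    Complex.re_ofReal_mul, Complex.im_ofReal_mul, Complex.I_re, Complex.I_im, mul_zero, mul_one,
    add_zero, zero_add]
  rw [add_comm (Real.pi / 2), Real.sin_add_pi_div_two]

theorem sin_one_div_twenty : 499 / 10000 ≤ Real.sin (1 / 20) := by
  have := Real.sin_gt_sub_cube (x := 1 / 20) (by norm_num)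
  norm_num at this ⊢
  linarith

/-- The modulus on the ray of argument `π / 2 + 1 / 20` near the origin. -/
theorem norm_averagedExp_ray_near {u : ℝ} (hu : Real.exp u ≤ 9 / 5) :
    ‖averagedExp (Complex.exp (u + (Real.pi / 2 + 1 / 20 : ℝ) * Complex.I))‖ ≤
      Real.exp (2 * (1 / 20) - 1 / 200) := by
  refine (norm_averagedExp_le _).trans ?_
  rw [exp_re_of_im_eq, neg_neg]
  -- The radius `9/5` is below 2 to leave room here: the exponent is at most `0.09`, against `2/20 -
  -- 1/200 = 0.095`.
  have h1 : Real.exp u * Real.sin (1 / 20) ≤ 9 / 5 * (1 / 20) :=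
    mul_le_mul hu (Real.sin_le (by norm_num)) (by linarith [sin_one_div_twenty]) (by norm_num)
  have h2 : Real.exp (Real.exp u * Real.sin (1 / 20)) ≤ Real.exp (2 * (1 / 20) - 1 / 200) :=
    Real.exp_le_exp.mpr (by linarith)
  have h3 : 1 ≤ Real.exp (2 * (1 / 20) - 1 / 200) := Real.one_le_exp (by norm_num)
  linarith

theorem le_exp_of_sq_le {a b : ℝ} (h : a ^ 2 ≤ 3 / 5) (hb : -(21 / 200) ≤ b) :
    a ≤ Real.exp b := by
  refine le_of_sq_le_sq ?_ (Real.exp_pos _).le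
  rw [← Real.exp_nat_mul]
  push_cast
  linarith [Real.add_one_le_exp (2 * b)]

/-- The modulus on the arc of radius `9 / 5`. -/
theorem norm_averagedExp_arc {u ψ : ℝ} (hu : Real.exp u = 9 / 5) (hψ : |ψ| ≤ 1 / 20) :
    ‖averagedExp (Complex.exp (u + (Real.pi / 2 + ψ : ℝ) * Complex.I))‖ ≤
      Real.exp (2 * ψ - 1 / 200) := by
  have hψ' := abs_le.mp hψ
  have hc1 : 999 / 1000 ≤ Real.cos ψ + 1 / 1000 := by
    nlinarith [Real.one_sub_sq_div_two_le_cos (x := ψ)]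
  have hc2 := Real.cos_le_one ψ
  have hs : Real.sin ψ ≤ 1 / 20 := by
    have := (Real.abs_sin_le_abs (x := ψ)).trans hψ
    exact (le_abs_self _).trans this
  -- The imaginary part `(9/5) cos ψ` exceeds `π/2`, and the squared modulus is then at most `(1 +
  -- 1.3)/4 < 3/5`.
  refine le_exp_of_sq_le ?_ (by linarith)
  refine (norm_averagedExp_sq_le ?_ ?_).trans ?_
  · rw [exp_im_of_im_eq, hu]
    linarith [Real.pi_lt_d2]
  · rw [exp_im_of_im_eq, hu]
    linarith [Real.pi_gt_d2]
  · rw [exp_re_of_im_eq, hu]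
    have h1 : Real.exp (-(2 * -(9 / 5 * Real.sin ψ))) ≤ Real.exp (18 / 100) :=
      Real.exp_le_exp.mpr (by linarith)
    have h2 : Real.exp (18 / 100) ≤ 1.3 := by
      have := Real.exp_bound_div_one_sub_of_interval (x := 18 / 100) (by norm_num) (by norm_num)
      norm_num at this ⊢
      linarith
    norm_num at h2
    linarith

/-- The modulus on the ray of argument `π / 2 - 1 / 20` away from the origin. -/
theorem norm_averagedExp_ray_far {u : ℝ} (hu : 9 / 5 ≤ Real.exp u) :
    ‖averagedExp (Complex.exp (u + (Real.pi / 2 + -(1 / 20) : ℝ) * Complex.I))‖ ≤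
      Real.exp (2 * -(1 / 20) - 1 / 200) := by
  have hs := sin_one_div_twenty
  -- `47/10` is just below `3π/2`. Up to this radius the cross term is nonpositive; beyond it `Re x
  -- ≥ 0.2345` suffices with the triangle inequality.
  rcases le_total (Real.exp u) (47 / 10) with h | h
  · refine le_exp_of_sq_le ?_ (by norm_num)
    have hc1 : 9 / 10 ≤ Real.cos (1 / 20) := by
      have := Real.one_sub_sq_div_two_le_cos (x := 1 / 20)
      norm_num at this ⊢
      linarith
    have hc2 := Real.cos_le_one (1 / 20)
    refine (norm_averagedExp_sq_le ?_ ?_).trans ?_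
    · rw [exp_im_of_im_eq, Real.cos_neg]
      nlinarith [Real.pi_lt_d2]
    · rw [exp_im_of_im_eq, Real.cos_neg]
      nlinarith [Real.pi_gt_d2]
    · rw [exp_re_of_im_eq, Real.sin_neg]
      have h1 : Real.exp (-(2 * -(Real.exp u * -Real.sin (1 / 20)))) ≤ 1 :=
        Real.exp_le_one_iff.mpr (by nlinarith)
      linarith
  · refine (norm_averagedExp_le _).trans ?_
    rw [exp_re_of_im_eq, Real.sin_neg, neg_neg]
    have h1 : Real.exp (Real.exp u * -Real.sin (1 / 20)) ≤ Real.exp (-(2345 / 10000)) :=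
      Real.exp_le_exp.mpr (by nlinarith)
    have h2 : Real.exp (-(2345 / 10000)) ≤ 0.793 := by
      rw [Real.exp_neg, inv_le_comm₀ (Real.exp_pos _) (by norm_num)]
      have := Real.quadratic_le_exp_of_nonneg (x := 2345 / 10000) (by norm_num)
      norm_num at this ⊢
      linarith
    have h3 : 0.8975 ≤ Real.exp (2 * -(1 / 20) - 1 / 200) := by
      have h4 : (2 * -(1 / 20) - 1 / 200 : ℝ) = (2 : ℕ) * (-(105 / 2000)) := by norm_num
      have h5 := Real.add_one_le_exp (-(105 / 2000) : ℝ)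
      rw [h4, Real.exp_nat_mul]
      refine le_trans ?_ (pow_le_pow_left₀ (by norm_num) h5 2)
      norm_num
    have h4 := h1.trans h2
    rw [mul_neg] at h4
    norm_num at h3 h4 ⊢
    linarith

/-- On the contour, the decay of `|x^{it}|` compensates the size of the kernel. -/
theorem exp_mul_norm_pow_le {N : ℕ} {t ψ a : ℝ} (h1 : 2 * N ≤ t) (h2 : t ≤ 2 * N + 2)
    (hψ : |ψ| ≤ 1 / 20) (ha0 : 0 ≤ a) (ha : a ≤ Real.exp (2 * ψ - 1 / 200)) :
    Real.exp (-t * (Real.pi / 2 + ψ)) * a ^ N ≤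
      2 * (Real.exp (-(Real.pi / 2 * t)) * Real.exp (-(N / 200))) := by
  have h3 : a ^ N ≤ Real.exp (N * (2 * ψ - 1 / 200)) := by
    rw [Real.exp_nat_mul]
    gcongr
  have h4 : Real.exp (1 / 10) ≤ 2 := by
    have := Real.exp_bound_div_one_sub_of_interval (x := 1 / 10) (by norm_num) (by norm_num)
    norm_num at this ⊢
    linarith
  -- Here `N = [t/2]` enters: the two exponents linear in `ψ` cancel up to `|2N - t| ≤ 2`.
  have h5 : (2 * N - t) * ψ ≤ 1 / 10 := by
    have hψ' := abs_le.mp hψ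
    nlinarith
  calc _ ≤ Real.exp (-t * (Real.pi / 2 + ψ)) * Real.exp (N * (2 * ψ - 1 / 200)) := by gcongr
    _ = Real.exp ((2 * N - t) * ψ) * (Real.exp (-(Real.pi / 2 * t)) * Real.exp (-(N / 200))) := by
      rw [← Real.exp_add, ← Real.exp_add, ← Real.exp_add]
      ring_nf
    _ ≤ _ := by
      gcongr
      exact (Real.exp_le_exp.mpr h5).trans h4

/-! ### Contour deformation in the logarithmic coordinate -/

/-- The integrand of the Mellin transform of `(eulerKernel N)'` at `1 / 2 + it` in the
logarithmic coordinate. -/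
noncomputable def mellinIntegrand (N : ℕ) (t : ℝ) (w : ℂ) : ℂ :=
  Complex.exp ((1 / 2 + Complex.I * t) * w) * deriv (eulerKernel N) (Complex.exp w)

theorem differentiableAt_mellinIntegrand (N : ℕ) (t : ℝ) {w : ℂ}
    (hw : Complex.exp w ∈ kernelRegion) : DifferentiableAt ℂ (mellinIntegrand N t) w := by
  have h1 : DifferentiableAt ℂ (fun w => Complex.exp ((1 / 2 + Complex.I * t) * w)) w := by fun_prop
  exact h1.mul ((differentiableAt_deriv_eulerKernel N hw).comp w
    Complex.differentiable_exp.differentiableAt)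

theorem norm_mellinIntegrand (N : ℕ) (t : ℝ) (w : ℂ) : ‖mellinIntegrand N t w‖ =
    Real.exp (w.re / 2) * Real.exp (-t * w.im) * ‖deriv (eulerKernel N) (Complex.exp w)‖ := by
  rw [mellinIntegrand, norm_mul, Complex.norm_exp, ← Real.exp_add]
  congr 2
  simp
  ring

theorem mellinIntegrand_ofReal (N : ℕ) (t u : ℝ) : mellinIntegrand N t u =
    Real.exp u • (((Real.exp u : ℝ) : ℂ) ^ ((1 / 2 + Complex.I * t) - 1) •
      deriv (eulerKernel N) ((Real.exp u : ℝ) : ℂ)) := by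
  have h0 : ((Real.exp u : ℝ) : ℂ) ≠ 0 := by exact_mod_cast (Real.exp_pos u).ne'
  rw [mellinIntegrand, Complex.real_smul, smul_eq_mul, ← mul_assoc,
    Complex.cpow_def_of_ne_zero h0, ← Complex.ofReal_log (Real.exp_pos u).le, Real.log_exp,
    Complex.ofReal_exp, ← Complex.exp_add]
  ring_nf

theorem tendsto_integral_mellinIntegrand (N : ℕ) (t : ℝ) :
    Tendsto (fun R : ℝ => ∫ u in (-R)..R, mellinIntegrand N t u) atTop
      (𝓝 (mellin (fun x : ℝ => deriv (eulerKernel N) x) (1 / 2 + Complex.I * t))) := by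
  have hs : 0 < (1 / 2 + Complex.I * t : ℂ).re := by simp
  have hconv := mellinConvergent_deriv_eulerKernel N hs
  have himage : Real.exp '' Set.univ = Set.Ioi 0 := by rw [Set.image_univ, Real.range_exp]
  have hd : ∀ x ∈ (Set.univ : Set ℝ), HasDerivWithinAt Real.exp (Real.exp x) Set.univ x :=
    fun x _ => (Real.hasDerivAt_exp x).hasDerivWithinAt
  rw [MellinConvergent, ← himage, integrableOn_image_iff_integrableOn_abs_deriv_smul
    MeasurableSet.univ hd Real.exp_injective.injOn] at hconv
  rw [mellin, ← himage, integral_image_eq_integral_abs_deriv_smul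
    MeasurableSet.univ hd Real.exp_injective.injOn]
  simp only [Real.abs_exp, ← mellinIntegrand_ofReal, Measure.restrict_univ,
    integrableOn_univ] at hconv ⊢
  exact intervalIntegral_tendsto_integral hconv tendsto_neg_atTop_atBot tendsto_id

theorem exp_mem_kernelRegion_of_le {w : ℂ} (hw : Real.exp w.re ≤ 9 / 5) :
    Complex.exp w ∈ kernelRegion :=
  Or.inl (by rw [Complex.norm_exp]; linarith)

theorem re_exp_ge {w : ℂ} (h0 : 0 ≤ w.im) (h1 : w.im ≤ Real.pi / 2 + -(1 / 20)) :
    499 / 10000 * Real.exp w.re ≤ (Complex.exp w).re := by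
  rw [Complex.exp_re, mul_comm]
  have h2 : Real.cos (Real.pi / 2 + -(1 / 20)) ≤ Real.cos w.im :=
    Real.cos_le_cos_of_nonneg_of_le_pi h0 (by linarith [Real.pi_pos]) h1
  rw [add_comm, Real.cos_add_pi_div_two, Real.sin_neg, neg_neg] at h2
  have := sin_one_div_twenty
  gcongr
  linarith

theorem exp_mem_kernelRegion_of_ge {w : ℂ} (hw : 9 / 5 ≤ Real.exp w.re)
    (h0 : 0 ≤ w.im) (h1 : w.im ≤ Real.pi / 2 + -(1 / 20)) :
    Complex.exp w ∈ kernelRegion :=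
  Or.inr (by linarith [re_exp_ge h0 h1])

/-- The last factors make the integrand integrable at both ends of the logarithmic line: `e^{Re
w/2}` is `|x|^{1/2}` at the origin, and `e^{-Re w}` comes from the exponential decay of the kernel
in `Re x`, which is at least a fixed multiple of `|x|` in the sector. -/
theorem exists_norm_mellinIntegrand_le : ∃ D : ℝ, 0 < D ∧ ∀ (N : ℕ) (t : ℝ) (w : ℂ),
    (Real.exp w.re ≤ 9 / 5 → ‖mellinIntegrand N t w‖ ≤ D * (N + 1) *
      (Real.exp (-t * w.im) * ‖averagedExp (Complex.exp w)‖ ^ N) * Real.exp (w.re / 2)) ∧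
    (9 / 5 ≤ Real.exp w.re → 0 ≤ w.im → w.im ≤ Real.pi / 2 + -(1 / 20) →
      ‖mellinIntegrand N t w‖ ≤ D * (N + 1) *
      (Real.exp (-t * w.im) * ‖averagedExp (Complex.exp w)‖ ^ N) * Real.exp (-w.re)) := by
  obtain ⟨C, hC, hbd⟩ := exists_norm_deriv_eulerKernel_le
  set m : ℝ := 499 / 10000 with hm
  refine ⟨C * (3 * Real.exp 2 + 48 / m ^ 4), by positivity, fun N t w => ⟨fun hw => ?_,
    fun hw h0 h1 => ?_⟩⟩
  · have h := hbd N _ (exp_mem_kernelRegion_of_le hw)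
    rw [norm_mellinIntegrand]
    rw [Complex.norm_exp] at h
    have hre : -(Complex.exp w).re ≤ 2 := by
      have := (abs_le.mp (Complex.abs_re_le_norm (Complex.exp w))).1
      rw [Complex.norm_exp] at this
      linarith
    have h2 : (1 + Real.exp w.re) * Real.exp (-(Complex.exp w).re) ≤
        3 * Real.exp 2 + 48 / m ^ 4 := by
      calc _ ≤ 3 * Real.exp 2 := by gcongr; linarith
        _ ≤ _ := by linarith [show 0 ≤ 48 / m ^ 4 by positivity]
    calc _ ≤ Real.exp (w.re / 2) * Real.exp (-t * w.im) *
          (C * (N + 1) * ‖averagedExp (Complex.exp w)‖ ^ N *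
            (3 * Real.exp 2 + 48 / m ^ 4)) := by
          gcongr
          exact h.trans (by gcongr)
      _ = _ := by ring
  · have h := hbd N _ (exp_mem_kernelRegion_of_ge hw h0 h1)
    rw [norm_mellinIntegrand]
    rw [Complex.norm_exp] at h
    set r := Real.exp w.re with hr
    have hr0 : 0 < r := Real.exp_pos _
    have hre : m * r ≤ (Complex.exp w).re := re_exp_ge h0 h1
    have h2 : Real.exp (w.re / 2) * ((1 + r) * Real.exp (-(Complex.exp w).re)) ≤
        (3 * Real.exp 2 + 48 / m ^ 4) * Real.exp (-w.re) := by
      have h3 : Real.exp (w.re / 2) ≤ r := by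
        have h7 : 0 ≤ w.re := by
          by_contra h8
          have := Real.exp_le_one_iff.mpr (not_le.mp h8).le
          linarith
        exact Real.exp_le_exp.mpr (by linarith)
      -- The fourth power absorbs the growth `r · 2r` and still leaves `r^{-2}`; this produces
      -- `48/m^4`.
      have h4 : (m * r) ^ 4 / 24 ≤ Real.exp (m * r) := by
        have := Real.pow_div_factorial_le_exp (m * r) (by positivity) 4
        norm_num [Nat.factorial] at this ⊢
        exact this
      have h5 : Real.exp (-(Complex.exp w).re) ≤ (Real.exp (m * r))⁻¹ := by
        rw [← Real.exp_neg]
        exact Real.exp_le_exp.mpr (by linarith)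
      have h6 : (Real.exp (m * r))⁻¹ ≤ 24 / (m * r) ^ 4 := by
        rw [inv_le_comm₀ (Real.exp_pos _) (by positivity), inv_div]
        exact h4
      rw [Real.exp_neg w.re, ← hr]
      calc _ ≤ r * ((r + r) * (24 / (m * r) ^ 4)) := by
            gcongr
            · linarith
            · exact h5.trans h6
        _ = 48 / m ^ 4 * r⁻¹ * r⁻¹ := by field_simp; ring
        _ ≤ 48 / m ^ 4 * r⁻¹ * 1 := by
            gcongr
            exact inv_le_one_of_one_le₀ (by linarith)
        _ ≤ _ := by
            rw [mul_one]
            gcongr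
            linarith [Real.exp_pos 2]
    calc _ ≤ Real.exp (w.re / 2) * Real.exp (-t * w.im) *
          (C * (N + 1) * ‖averagedExp (Complex.exp w)‖ ^ N *
            ((1 + r) * Real.exp (-(Complex.exp w).re))) := by gcongr
      _ = C * (N + 1) * (Real.exp (-t * w.im) * ‖averagedExp (Complex.exp w)‖ ^ N) *
          (Real.exp (w.re / 2) * ((1 + r) * Real.exp (-(Complex.exp w).re))) := by ring
      _ ≤ C * (N + 1) * (Real.exp (-t * w.im) * ‖averagedExp (Complex.exp w)‖ ^ N) *
          ((3 * Real.exp 2 + 48 / m ^ 4) * Real.exp (-w.re)) := by gcongr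
      _ = _ := by ring

/-- Cauchy's theorem on two rectangles of different heights that meet along `Re w = log(9/5)`. The
common part of that side cancels, and what remains of it is the arc joining the two rays. -/
theorem integral_mellinIntegrand_eq (N : ℕ) (t R : ℝ) (hR : |Real.log (9 / 5)| ≤ R) :
    ∫ u in (-R)..R, mellinIntegrand N t u =
      (∫ u in (-R)..Real.log (9 / 5),
        mellinIntegrand N t (u + (Real.pi / 2 + 1 / 20 : ℝ) * Complex.I)) +
      (∫ u in Real.log (9 / 5)..R,
        mellinIntegrand N t (u + (Real.pi / 2 + -(1 / 20) : ℝ) * Complex.I)) -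
      Complex.I * (∫ y in (Real.pi / 2 + -(1 / 20))..(Real.pi / 2 + 1 / 20),
        mellinIntegrand N t (Real.log (9 / 5) + y * Complex.I)) +
      Complex.I * (∫ y in 0..(Real.pi / 2 + 1 / 20), mellinIntegrand N t ((-R : ℝ) + y * Complex.I)) -
      Complex.I * (∫ y in 0..(Real.pi / 2 + -(1 / 20)), mellinIntegrand N t (R + y * Complex.I)) := by
  set u₀ := Real.log (9 / 5) with hu₀
  have hexp : Real.exp u₀ = 9 / 5 := Real.exp_log (by norm_num)
  obtain ⟨hR1, hR2⟩ := abs_le.mp hR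
  have hpi := Real.pi_gt_three
  have hleft := Complex.integral_boundary_rect_eq_zero_of_differentiableOn (mellinIntegrand N t)
    ((-R : ℝ) : ℂ) (u₀ + (Real.pi / 2 + 1 / 20 : ℝ) * Complex.I) (fun w hw => by
      refine (differentiableAt_mellinIntegrand N t
        (exp_mem_kernelRegion_of_le ?_)).differentiableWithinAt
      have h := hw.1
      simp only [Complex.ofReal_re, Complex.add_re, Complex.re_ofReal_mul, Complex.I_re, mul_zero,
        add_zero, Set.mem_preimage, Set.uIcc_of_le (by linarith : -R ≤ u₀), Set.mem_Icc] at h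
      rw [← hexp]
      exact Real.exp_le_exp.mpr h.2)
  have hright := Complex.integral_boundary_rect_eq_zero_of_differentiableOn (mellinIntegrand N t)
    (u₀ : ℂ) (R + (Real.pi / 2 + -(1 / 20) : ℝ) * Complex.I) (fun w hw => by
      have h := hw.1
      have h' := hw.2
      simp only [Complex.ofReal_re, Complex.add_re, Complex.re_ofReal_mul, Complex.I_re, mul_zero,
        add_zero, Set.mem_preimage, Set.uIcc_of_le hR2, Set.mem_Icc] at h
      simp only [Complex.ofReal_im, Complex.add_im, Complex.im_ofReal_mul, Complex.I_im, mul_one,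
        zero_add, Set.mem_preimage,
        Set.uIcc_of_le (by linarith : (0 : ℝ) ≤ Real.pi / 2 + -(1 / 20)), Set.mem_Icc] at h'
      refine (differentiableAt_mellinIntegrand N t
        (exp_mem_kernelRegion_of_ge ?_ h'.1 h'.2)).differentiableWithinAt
      rw [← hexp]
      exact Real.exp_le_exp.mpr h.1)
  simp only [Complex.ofReal_re, Complex.add_re, Complex.re_ofReal_mul, Complex.I_re, mul_zero,
    add_zero, Complex.ofReal_im, Complex.add_im, Complex.im_ofReal_mul, Complex.I_im, mul_one,
    zero_add, smul_eq_mul] at hleft hright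
  simp only [Complex.ofReal_zero, zero_mul, add_zero] at hleft hright
  have hbase : ∀ a b : ℝ, (∀ u ∈ Set.uIcc a b, Complex.exp (u : ℂ) ∈ kernelRegion) →
      IntervalIntegrable (fun u : ℝ => mellinIntegrand N t u) volume a b := fun a b h =>
    ContinuousOn.intervalIntegrable fun u hu =>
      ((differentiableAt_mellinIntegrand N t (h u hu)).continuousAt.comp
        (f := fun u : ℝ => (u : ℂ)) Complex.continuous_ofReal.continuousAt).continuousWithinAt
  have hreal : ∀ u : ℝ, Complex.exp (u : ℂ) ∈ kernelRegion := fun u => by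
    rw [← Complex.ofReal_exp]
    exact ofReal_mem_kernelRegion (Real.exp_pos u).le
  have hvert : ∀ a b : ℝ,
      IntervalIntegrable (fun y : ℝ => mellinIntegrand N t (u₀ + y * Complex.I)) volume a b :=
    fun a b => Continuous.intervalIntegrable (continuous_iff_continuousAt.mpr fun y =>
      ContinuousAt.comp (f := fun y : ℝ => (u₀ + y * Complex.I : ℂ))
        (differentiableAt_mellinIntegrand N t (exp_mem_kernelRegion_of_le
          (by simp [hexp]))).continuousAt (by fun_prop)) a b
  rw [← intervalIntegral.integral_add_adjacent_intervals (hbase (-R) u₀ fun u _ => hreal u)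
    (hbase u₀ R fun u _ => hreal u)]
  rw [← intervalIntegral.integral_add_adjacent_intervals
    (hvert 0 (Real.pi / 2 + -(1 / 20))) (hvert _ (Real.pi / 2 + 1 / 20))] at hleft
  linear_combination hleft + hright

/-- As the rectangles widen, their outer vertical sides vanish; the two rays and the arc contribute
at most `8 + 8 + 4 = 20` units. -/
theorem exists_norm_mellin_le : ∃ K : ℝ, 0 < K ∧ ∀ (N : ℕ) (t : ℝ), 2 * N ≤ t → t ≤ 2 * N + 2 →
    ‖mellin (fun x : ℝ => deriv (eulerKernel N) x) (1 / 2 + Complex.I * t)‖ ≤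
      K * (N + 1) * (Real.exp (-(Real.pi / 2 * t)) * Real.exp (-(N / 200))) := by
  obtain ⟨D, hD, hbd⟩ := exists_norm_mellinIntegrand_le
  refine ⟨20 * D, by positivity, fun N t h1 h2 => ?_⟩
  set S := Real.exp (-(Real.pi / 2 * t)) * Real.exp (-(N / 200)) with hS
  have hS0 : 0 < S := by positivity
  set P := D * (N + 1) with hP
  have hP0 : 0 < P := by positivity
  have ht : 0 ≤ t := le_trans (by positivity) h1
  set u₀ := Real.log (9 / 5) with hu₀
  have hexp : Real.exp u₀ = 9 / 5 := Real.exp_log (by norm_num)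
  have hu₀0 : 0 ≤ u₀ := Real.log_nonneg (by norm_num)
  have hexp2 : Real.exp (u₀ / 2) ≤ 9 / 5 := by
    rw [← hexp]
    exact Real.exp_le_exp.mpr (by linarith)
  have hpi := Real.pi_gt_three
  have hpi' := Real.pi_lt_four
  have hcomp : ∀ u ψ : ℝ, (u + (Real.pi / 2 + ψ : ℝ) * Complex.I : ℂ).re = u ∧
      (u + (Real.pi / 2 + ψ : ℝ) * Complex.I : ℂ).im = Real.pi / 2 + ψ := fun u ψ => by
    constructor <;> simp
  have hcomp' : ∀ u y : ℝ, (u + y * Complex.I : ℂ).re = u ∧ (u + y * Complex.I : ℂ).im = y :=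
    fun u y => by constructor <;> simp
  have hnear : ∀ R : ℝ, |u₀| ≤ R → ‖∫ u in (-R)..u₀,
      mellinIntegrand N t (u + (Real.pi / 2 + 1 / 20 : ℝ) * Complex.I)‖ ≤ 8 * P * S := by
    intro R hR
    have hle : -R ≤ u₀ := by linarith [(abs_le.mp hR).1]
    refine (intervalIntegral.norm_integral_le_of_norm_le (g := fun u => P * (2 * S) * Real.exp (u / 2))
      hle (ae_of_all _ fun u hu => ?_) (Continuous.intervalIntegrable (by fun_prop) _ _)).trans ?_
    · have hur : Real.exp u ≤ 9 / 5 := by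
        rw [← hexp]
        exact Real.exp_le_exp.mpr hu.2
      have h3 := (hbd N t (u + (Real.pi / 2 + 1 / 20 : ℝ) * Complex.I)).1
      rw [(hcomp u (1 / 20)).1, (hcomp u (1 / 20)).2] at h3
      refine (h3 hur).trans ?_
      exact mul_le_mul_of_nonneg_right (mul_le_mul_of_nonneg_left (exp_mul_norm_pow_le h1 h2
        (by norm_num) (norm_nonneg _) (norm_averagedExp_ray_near hur)) hP0.le) (Real.exp_pos _).le
    · have hI : ∫ u in (-R)..u₀, Real.exp (u / 2) = 2 * (Real.exp (u₀ / 2) - Real.exp (-R / 2)) := by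
        simp
      rw [intervalIntegral.integral_const_mul, hI]
      have h4 := Real.exp_pos (-R / 2)
      calc P * (2 * S) * (2 * (Real.exp (u₀ / 2) - Real.exp (-R / 2)))
          ≤ P * (2 * S) * (2 * 2) := by gcongr; linarith
        _ = _ := by ring
  have hfar : ∀ R : ℝ, |u₀| ≤ R → ‖∫ u in u₀..R,
      mellinIntegrand N t (u + (Real.pi / 2 + -(1 / 20) : ℝ) * Complex.I)‖ ≤ 8 * P * S := by
    intro R hR
    have hle : u₀ ≤ R := (abs_le.mp hR).2
    refine (intervalIntegral.norm_integral_le_of_norm_le (g := fun u => P * (2 * S) * Real.exp (-u))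
      hle (ae_of_all _ fun u hu => ?_) (Continuous.intervalIntegrable (by fun_prop) _ _)).trans ?_
    · have hur : 9 / 5 ≤ Real.exp u := by
        rw [← hexp]
        exact Real.exp_le_exp.mpr hu.1.le
      have h3 := (hbd N t (u + (Real.pi / 2 + -(1 / 20) : ℝ) * Complex.I)).2
      rw [(hcomp u (-(1 / 20))).1, (hcomp u (-(1 / 20))).2] at h3
      refine (h3 hur (by linarith) le_rfl).trans ?_
      exact mul_le_mul_of_nonneg_right (mul_le_mul_of_nonneg_left (exp_mul_norm_pow_le h1 h2
        (by norm_num) (norm_nonneg _) (norm_averagedExp_ray_far hur)) hP0.le) (Real.exp_pos _).le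
    · have hI : ∫ u in u₀..R, Real.exp (-u) = Real.exp (-u₀) - Real.exp (-R) := by simp
      rw [intervalIntegral.integral_const_mul, hI]
      have h4 := Real.exp_pos (-R)
      have h5 : Real.exp (-u₀) ≤ 1 := Real.exp_le_one_iff.mpr (by linarith)
      calc P * (2 * S) * (Real.exp (-u₀) - Real.exp (-R)) ≤ P * (2 * S) * 4 := by
            gcongr; linarith
        _ = _ := by ring
  have harc : ‖∫ y in (Real.pi / 2 + -(1 / 20))..(Real.pi / 2 + 1 / 20),
      mellinIntegrand N t (u₀ + y * Complex.I)‖ ≤ 4 * P * S := by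
    refine (intervalIntegral.norm_integral_le_of_norm_le_const (C := P * (2 * S) * (9 / 5))
      fun y hy => ?_).trans ?_
    · rw [Set.uIoc_of_le (by linarith)] at hy
      have h3 := (hbd N t (u₀ + y * Complex.I)).1
      rw [(hcomp' u₀ y).1, (hcomp' u₀ y).2] at h3
      refine (h3 hexp.le).trans ?_
      obtain ⟨ψ, rfl⟩ : ∃ ψ, y = Real.pi / 2 + ψ := ⟨y - Real.pi / 2, by ring⟩
      have hψ : |ψ| ≤ 1 / 20 := abs_le.mpr ⟨by linarith [hy.1], by linarith [hy.2]⟩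
      exact mul_le_mul (mul_le_mul_of_nonneg_left (exp_mul_norm_pow_le h1 h2 hψ (norm_nonneg _)
        (norm_averagedExp_arc hexp hψ)) hP0.le) hexp2 (Real.exp_pos _).le (by positivity)
    · rw [abs_of_nonneg (by linarith)]
      nlinarith [mul_pos hP0 hS0]
  have hleft : Tendsto (fun R : ℝ => ∫ y in 0..(Real.pi / 2 + 1 / 20),
      mellinIntegrand N t ((-R : ℝ) + y * Complex.I)) atTop (𝓝 0) := by
    have hlim : Tendsto (fun R : ℝ => P * (1 * Real.exp 2 ^ N) * Real.exp (-R / 2) *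
        |Real.pi / 2 + 1 / 20 - 0|) atTop (𝓝 0) := by
      have h3 : Tendsto (fun R : ℝ => Real.exp (-R / 2)) atTop (𝓝 0) :=
        Real.tendsto_exp_atBot.comp (tendsto_neg_atTop_atBot.atBot_div_const (by norm_num))
      simpa using (h3.const_mul (P * (1 * Real.exp 2 ^ N))).mul_const |Real.pi / 2 + 1 / 20 - 0|
    refine squeeze_zero_norm' ?_ hlim
    filter_upwards [eventually_ge_atTop 0] with R hR
    refine intervalIntegral.norm_integral_le_of_norm_le_const fun y hy => ?_
    rw [Set.uIoc_of_le (by linarith)] at hy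
    have h3 := (hbd N t ((-R : ℝ) + y * Complex.I)).1
    rw [(hcomp' (-R) y).1, (hcomp' (-R) y).2] at h3
    have h4 : Real.exp (-R) ≤ 1 := Real.exp_le_one_iff.mpr (by linarith)
    refine (h3 (by linarith)).trans ?_
    have h5 : Real.exp (-t * y) ≤ 1 := Real.exp_le_one_iff.mpr (by nlinarith [hy.1])
    have h6 : ‖averagedExp (Complex.exp ((-R : ℝ) + y * Complex.I))‖ ≤ Real.exp 2 := by
      refine (norm_averagedExp_le _).trans ?_
      have h7 := (abs_le.mp (Complex.abs_re_le_norm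
        (Complex.exp ((-R : ℝ) + y * Complex.I)))).1
      rw [Complex.norm_exp, (hcomp' (-R) y).1] at h7
      have h8 : Real.exp (-(Complex.exp ((-R : ℝ) + y * Complex.I)).re) ≤ Real.exp 2 :=
        Real.exp_le_exp.mpr (by linarith)
      have h9 : 1 ≤ Real.exp 2 := Real.one_le_exp (by norm_num)
      linarith
    gcongr
  have hright : Tendsto (fun R : ℝ => ∫ y in 0..(Real.pi / 2 + -(1 / 20)),
      mellinIntegrand N t (R + y * Complex.I)) atTop (𝓝 0) := by
    have hlim : Tendsto (fun R : ℝ => P * (1 * 1 ^ N) * Real.exp (-R) *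
        |Real.pi / 2 + -(1 / 20) - 0|) atTop (𝓝 0) := by
      simpa using (Real.tendsto_exp_neg_atTop_nhds_zero.const_mul (P * (1 * 1 ^ N))).mul_const
        |Real.pi / 2 + -(1 / 20) - 0|
    refine squeeze_zero_norm' ?_ hlim
    filter_upwards [eventually_ge_atTop u₀] with R hR
    refine intervalIntegral.norm_integral_le_of_norm_le_const fun y hy => ?_
    rw [Set.uIoc_of_le (by linarith)] at hy
    have h3 := (hbd N t (R + y * Complex.I)).2
    have h4 : 9 / 5 ≤ Real.exp R := by
      rw [← hexp]
      exact Real.exp_le_exp.mpr hR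
    have hre := re_exp_ge (w := (R + y * Complex.I : ℂ))
    rw [(hcomp' R y).1, (hcomp' R y).2] at h3 hre
    have hre' := hre hy.1.le hy.2
    refine (h3 h4 hy.1.le hy.2).trans ?_
    have h5 : Real.exp (-t * y) ≤ 1 := Real.exp_le_one_iff.mpr (by nlinarith [hy.1])
    have h6 := norm_averagedExp_le_one (x := Complex.exp (R + y * Complex.I))
      (le_trans (by positivity) hre')
    gcongr
  have hmain : ∀ᶠ R : ℝ in atTop, ‖(∫ u in (-R)..R, mellinIntegrand N t u) -
      (Complex.I * (∫ y in 0..(Real.pi / 2 + 1 / 20),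
        mellinIntegrand N t ((-R : ℝ) + y * Complex.I)) -
      Complex.I * (∫ y in 0..(Real.pi / 2 + -(1 / 20)), mellinIntegrand N t (R + y * Complex.I)))‖ ≤
      20 * P * S := by
    filter_upwards [eventually_ge_atTop |u₀|] with R hR
    have hcancel : ∀ a b c d e : ℂ, a + b - c + d - e - (d - e) = a + b - c := fun _ _ _ _ _ => by
      ring
    rw [integral_mellinIntegrand_eq N t R hR, hcancel]
    refine (norm_sub_le _ _).trans ((add_le_add (norm_add_le _ _) le_rfl).trans ?_)
    rw [norm_mul, Complex.norm_I, one_mul]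
    linarith [hnear R hR, hfar R hR, harc]
  have hlim := (tendsto_integral_mellinIntegrand N t).sub
    ((hleft.const_mul Complex.I).sub (hright.const_mul Complex.I))
  rw [mul_zero, sub_zero, sub_zero] at hlim
  refine (le_of_tendsto hlim.norm hmain).trans_eq ?_
  rw [hP]
  ring

/-! ### Division by the Gamma factor and conclusion -/

/-- Since `1 - s` is the conjugate of `s`, the reflection formula gives `|Γ(s)|^2 = π/|sin πs|`, and
`|sin πs| ≤ e^{πt}`. -/
theorem exp_le_norm_Gamma_critical {t : ℝ} (ht : 0 ≤ t) :
    Real.exp (-(Real.pi / 2 * t)) ≤ ‖Complex.Gamma (1 / 2 + Complex.I * t)‖ := by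
  set s : ℂ := 1 / 2 + Complex.I * t with hs
  refine le_of_sq_le_sq ?_ (norm_nonneg _)
  have h1 := congrArg norm (Complex.Gamma_mul_Gamma_one_sub s)
  rw [← conj_critical t, ← hs, Complex.Gamma_conj, norm_mul, RCLike.norm_conj, norm_div,
    Complex.norm_real, Real.norm_of_nonneg Real.pi_pos.le, ← sq] at h1
  have him : (Real.pi * s).im = Real.pi * t := by
    rw [Complex.im_ofReal_mul]
    simp [hs]
  have h2 : ‖Complex.sin (Real.pi * s)‖ ≤ Real.exp (Real.pi * t) := by
    rw [Complex.sin, norm_div, norm_mul, Complex.norm_I, mul_one, Complex.norm_ofNat,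
      div_le_iff₀ two_pos]
    refine (norm_sub_le _ _).trans ?_
    rw [Complex.norm_exp, Complex.norm_exp, neg_mul, Complex.neg_re, Complex.mul_I_re, him, neg_neg]
    have h3 : Real.exp (-(Real.pi * t)) ≤ Real.exp (Real.pi * t) :=
      Real.exp_le_exp.mpr (by nlinarith [mul_nonneg Real.pi_pos.le ht])
    linarith
  have h0 : Complex.Gamma s ≠ 0 := Complex.Gamma_ne_zero_of_re_pos (by simp [hs])
  have hsin : 0 < ‖Complex.sin (Real.pi * s)‖ := by
    refine lt_of_le_of_ne (norm_nonneg _) fun h => ?_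
    rw [← h, div_zero] at h1
    exact h0 (norm_eq_zero.mp (pow_eq_zero_iff two_ne_zero |>.mp h1))
  rw [h1, ← Real.exp_nat_mul, le_div_iff₀ hsin]
  calc _ ≤ Real.exp ((2 : ℕ) * -(Real.pi / 2 * t)) * Real.exp (Real.pi * t) := by gcongr
    _ = 1 := by
      rw [← Real.exp_add, Real.exp_eq_one_iff]
      push_cast
      ring
    _ ≤ _ := by linarith [Real.pi_gt_three]

theorem exists_norm_zeta_sub_eulerPartialSum_le : ∃ K : ℝ, 0 < K ∧ ∀ (N : ℕ) (t : ℝ), 0 < t →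
    2 * N ≤ t → t ≤ 2 * N + 2 →
    ‖riemannZeta (1 / 2 + Complex.I * t) - eulerPartialSum N (1 / 2 + Complex.I * t)‖ ≤
      K * Real.exp (-(1 / 800) * t) := by
  obtain ⟨K, hK, hbd⟩ := exists_norm_mellin_le
  refine ⟨2 * K * (400 * Real.exp (1 / 200)), by positivity, fun N t ht h1 h2 => ?_⟩
  have h := hbd N t h1 h2
  rw [mellin_deriv_eulerKernel N (by simp) (by simpa using ht), norm_mul, norm_mul, norm_neg] at h
  set E := ‖riemannZeta (1 / 2 + Complex.I * t) - eulerPartialSum N (1 / 2 + Complex.I * t)‖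
  have hs : 1 / 2 ≤ ‖(1 / 2 + Complex.I * t : ℂ) - 1‖ := by
    refine le_trans ?_ (Complex.abs_re_le_norm _)
    norm_num [abs_of_nonneg]
  have hΓ := exp_le_norm_Gamma_critical ht.le
  have h3 : 1 / 2 * (Real.exp (-(Real.pi / 2 * t)) * E) ≤
      K * (N + 1) * (Real.exp (-(Real.pi / 2 * t)) * Real.exp (-(N / 200))) := by
    refine le_trans ?_ h
    gcongr
  have h4 : E ≤ 2 * K * ((N + 1) * Real.exp (-(N / 200))) := by
    have he := Real.exp_pos (-(Real.pi / 2 * t))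
    refine le_of_mul_le_mul_left ?_ he
    linarith
  -- Half of the rate `1/200` is spent on the linear factor. The remaining `(N + 1)/400` is at least
  -- `t/800`, which fixes `ω`.
  have h5 : (N : ℝ) + 1 ≤ 400 * Real.exp ((N + 1) / 400) := by
    linarith [Real.add_one_le_exp (((N : ℝ) + 1) / 400)]
  calc E ≤ 2 * K * (400 * Real.exp ((N + 1) / 400) * Real.exp (-(N / 200))) := by
        refine h4.trans ?_
        gcongr
    _ = 2 * K * (400 * Real.exp (1 / 200)) * Real.exp (-((N + 1) / 400)) := by
        rw [mul_assoc 400, mul_assoc (2 * K), mul_assoc 400, ← Real.exp_add, ← Real.exp_add]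
        ring_nf
    _ ≤ _ := by
        gcongr
        linarith

theorem spiraOrder_bounds {t : ℝ} (ht : 0 ≤ t) :
    2 * (spiraOrder t : ℝ) ≤ t ∧ t ≤ 2 * spiraOrder t + 2 := by
  have h1 := Nat.floor_le (div_nonneg ht two_pos.le)
  have h2 := Nat.lt_floor_add_one (t / 2)
  rw [spiraOrder]
  constructor <;> linarith

theorem abs_last_term_le {t : ℝ} (ht : 0 ≤ t) :
    |accCoeff (spiraOrder t + 1) t * (Real.cos (riemannSiegelTheta t -
      Real.log ((spiraOrder t + 1 : ℕ) : ℝ) * t) / √((spiraOrder t + 1 : ℕ) : ℝ))| ≤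
      Real.exp (-(1 / 800) * t) := by
  have hN := (spiraOrder_bounds ht).2
  set N := spiraOrder t with hNdef
  -- The sum over `n` from `N` to `N` has a single term.
  have hc : accCoeff (N + 1) t = 1 / 2 ^ (N + 1) := by
    rw [accCoeff, ← hNdef]
    simp
  have hsqrt : 1 ≤ √((N + 1 : ℕ) : ℝ) := by
    rw [Real.one_le_sqrt]
    push_cast
    linarith [(Nat.cast_nonneg N : (0 : ℝ) ≤ N)]
  have hfrac : |Real.cos (riemannSiegelTheta t - Real.log ((N + 1 : ℕ) : ℝ) * t) /
      √((N + 1 : ℕ) : ℝ)| ≤ 1 := by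
    rw [abs_div, abs_of_nonneg (Real.sqrt_nonneg _)]
    exact div_le_one_of_le₀ ((Real.abs_cos_le_one _).trans hsqrt) (Real.sqrt_nonneg _)
  have h2 : Real.exp (1 / 400) ≤ 2 := by
    have := Real.exp_bound_div_one_sub_of_interval (x := 1 / 400) (by norm_num) (by norm_num)
    norm_num at this ⊢
    linarith
  rw [abs_mul, hc, abs_of_pos (by positivity)]
  calc 1 / 2 ^ (N + 1) * |Real.cos (riemannSiegelTheta t - Real.log ((N + 1 : ℕ) : ℝ) * t) /
      √((N + 1 : ℕ) : ℝ)| ≤ 1 / Real.exp (1 / 400) ^ (N + 1) * 1 := by gcongr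
    _ = Real.exp (-((N + 1) / 400)) := by
      rw [← Real.exp_nat_mul, mul_one, one_div, ← Real.exp_neg]
      push_cast
      ring_nf
    _ ≤ _ := Real.exp_le_exp.mpr (by linarith)

theorem proposition2p1 :
    (∃ ω : ℝ, 0 < ω ∧
      (fun t : ℝ => hardyZ t - ((acceleratedSection (spiraOrder t) t : ℝ) : ℂ))
        =O[Filter.atTop] (fun t : ℝ => Real.exp (-ω * t)) ∧
      (fun t : ℝ => hardyZ t - ((∑ k ∈ Finset.Icc 1 (spiraOrder t),
          accCoeff k t * (Real.cos (riemannSiegelTheta t - Real.log k * t) / √(k : ℝ)) : ℝ) : ℂ))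
        =O[Filter.atTop] (fun t : ℝ => Real.exp (-ω * t))) ∧
    ∀ t : ℝ, 0 ≤ t →
      acceleratedSection (spiraOrder t) t = ∑ k ∈ Finset.Icc 1 (spiraOrder t + 1),
        accCoeff k t * (Real.cos (riemannSiegelTheta t - Real.log k * t) / √(k : ℝ)) := by
  obtain ⟨K, hK, hbd⟩ := exists_norm_zeta_sub_eulerPartialSum_le
  have hmain : ∀ t : ℝ, 0 < t → ‖hardyZ t - ((acceleratedSection (spiraOrder t) t : ℝ) : ℂ)‖ ≤
      K * Real.exp (-(1 / 800) * t) := fun t ht =>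
    (norm_hardyZ_sub_acceleratedSection_le _ t).trans
      (hbd _ t ht (spiraOrder_bounds ht.le).1 (spiraOrder_bounds ht.le).2)
  refine ⟨⟨1 / 800, by norm_num, ?_, ?_⟩, fun t _ => acceleratedSection_eq_sum_accCoeff t⟩
  · refine Asymptotics.IsBigO.of_bound K ?_
    filter_upwards [Filter.eventually_gt_atTop 0] with t ht
    rw [Real.norm_of_nonneg (Real.exp_pos _).le]
    exact hmain t ht
  · refine Asymptotics.IsBigO.of_bound (K + 1) ?_
    filter_upwards [Filter.eventually_gt_atTop 0] with t ht
    rw [Real.norm_of_nonneg (Real.exp_pos _).le]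
    have h1 := hmain t ht
    have h2 := abs_last_term_le ht.le
    rw [acceleratedSection_eq_sum_accCoeff, Finset.sum_Icc_succ_top (by omega),
      Complex.ofReal_add] at h1
    rw [← Real.norm_eq_abs, ← Complex.norm_real] at h2
    have h3 : ∀ z a b : ℂ, ‖z - a‖ ≤ ‖z - (a + b)‖ + ‖b‖ := fun z a b => by
      have h4 := norm_add_le (z - (a + b)) b
      rwa [show z - (a + b) + b = z - a by ring] at h4
    refine (h3 _ _ _).trans ((add_le_add h1 h2).trans_eq ?_)
    ring
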